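/- Let $d\ge 1$ and let $P$ be a log-concave probability measure on $\mathbb R^d$, i.e. $P(\lambda A+(1-\lambda)B)\ge P(A)^{\lambda}P(B)^{1-\lambda}$ for all non-empty Borel sets $A,B\subseteq\mathbb R^d$ and all $\lambda\in[0,1]$. Let $\mu$ be the expectation of $P$, and suppose that its variance matrix $\Sigma$ is positive definite. Let $L_P$ be the isotropic constant of $P$: if $T$ is an invertible affine map such that the image of $P$ under $T$ is isotropic (expectation $0$ and variance matrix $I_d$) with log-concave density $f$, then $L_P=(\sup f)^{1/d}$. For $x \in\mathbb R^d$ let $hD(x;P)$ be the halfspace depth of $x$, the infimum of $P(H)$ over all closed halfspaces $H$ that contain $x$, and let $P_\delta=\{x\in\mathbb R^d : hD(x;P)\ge\delta\}$. Write $d_\Sigma(x,\mu)=\sqrt{(x-\mu)^{\mathsf T}\Sigma^{-1}(x-\mu)}$ for the Mahalanobis distance. Then for every $\delta\in(0,1/e)$ $$\Big\{x : d_\Sigma(x,\mu)\le \tfrac1e-\delta\Big\}\ \subseteq\ P_\delta\ \subseteq\ \Big\{x : d_\Sigma(x,\mu)\le 17\log\big(\tfrac1\delta\big)\,L_P\Big\},$$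 and also $$P_\delta\ \subseteq\ \Big\{x : d_\Sigma(x,\mu)\le 17\log\big(\tfrac1\delta\big)\Big\}.$$ -/

import Mathlib

open MeasureTheory ProbabilityTheory
open scoped Pointwise ENNReal

/-- The Euclidean space `ℝ^d`. -/
abbrev RSpace (d : ℕ) : Type := EuclideanSpace ℝ (Fin d)

/-- A log-concave measure:
`P (t A + (1 - t) B) ≥ P(A)^t P(B)^(1-t)` for all non-empty Borel sets `A, B` and `t ∈ [0,1]`. -/
def IsLogConcaveMeasure {d : ℕ} (P : Measure (RSpace d)) : Prop :=
  ∀ A B : Set (RSpace d), MeasurableSet A → MeasurableSet B → A.Nonempty → B.Nonempty →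
    ∀ t : ℝ, 0 ≤ t → t ≤ 1 → P A ^ t * P B ^ (1 - t) ≤ P (t • A + (1 - t) • B)

/-- A log-concave function `f : ℝ^d → [0, ∞)`. -/
def IsLogConcaveFun {d : ℕ} (f : RSpace d → ℝ) : Prop :=
  (∀ x, 0 ≤ f x) ∧
    ∀ x y : RSpace d, ∀ t : ℝ, 0 ≤ t → t ≤ 1 →
      f x ^ t * f y ^ (1 - t) ≤ f (t • x + (1 - t) • y)

/-- `f` is a log-concave density of `P` with respect to the Lebesgue measure. -/
def IsLogConcaveDensity {d : ℕ} (P : Measure (RSpace d)) (f : RSpace d → ℝ) : Prop :=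
  IsLogConcaveFun f ∧ Measurable f ∧ P = volume.withDensity (fun x => ENNReal.ofReal (f x))

/-- The expectation of `P`. -/
noncomputable def meanVector {d : ℕ} (P : Measure (RSpace d)) : RSpace d := ∫ x, x ∂P

/-- The variance (covariance) matrix of `P`. -/
noncomputable def varianceMatrix {d : ℕ} (P : Measure (RSpace d)) : Matrix (Fin d) (Fin d) ℝ :=
  Matrix.of fun i j => covariance (fun x : RSpace d => x i) (fun x : RSpace d => x j) P

/-- `P` is isotropic: it is centered, and `∫ ⟨x, u⟩² dP(x) = 1` for every unit vector `u`. -/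
def IsIsotropicMeasure {d : ℕ} (P : Measure (RSpace d)) : Prop :=
  meanVector P = 0 ∧ ∀ u : RSpace d, ‖u‖ = 1 → ∫ x, (inner ℝ x u) ^ 2 ∂P = 1

/-- `L` is the isotropic constant of `P`: some affine image of `P` is isotropic with a log-concave
density `f`, and `L = (sup f)^(1/d)`. -/
def IsIsotropicConstant {d : ℕ} (P : Measure (RSpace d)) (L : ℝ) : Prop :=
  ∃ (T : RSpace d ≃ᵃ[ℝ] RSpace d) (f : RSpace d → ℝ),
    IsIsotropicMeasure (P.map T) ∧ IsLogConcaveDensity (P.map T) f ∧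
      L = (⨆ x, f x) ^ (1 / (d : ℝ))

open Classical in
/-- The isotropic constant `L_P`. The number `L` in `IsIsotropicConstant P L` does not depend on the
choice of the isotropic affine image; the value is `0` if there is no such image. -/
noncomputable def isotropicConstant {d : ℕ} (P : Measure (RSpace d)) : ℝ :=
  if h : ∃ L, IsIsotropicConstant P L then h.choose else 0

/-- The halfspace (Tukey) depth of `x` with respect to `P`: the infimum of `P` over all closed
halfspaces `{z | ⟨z, u⟩ ≤ a}`, `u ≠ 0`, that contain `x`. -/
noncomputable def halfspaceDepth {d : ℕ} (x : RSpace d) (P : Measure (RSpace d)) : ℝ≥0∞ :=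
  ⨅ (u : RSpace d) (_ : u ≠ 0) (a : ℝ) (_ : inner ℝ x u ≤ a), P {z | inner ℝ z u ≤ a}

/-- The central region `P_δ`, the set of points whose halfspace depth is at least `δ`. -/
def depthRegion {d : ℕ} (P : Measure (RSpace d)) (δ : ℝ) : Set (RSpace d) :=
  {y | ENNReal.ofReal δ ≤ halfspaceDepth y P}

/-- The Mahalanobis distance `√((x - y)ᵀ S⁻¹ (x - y))`. -/
noncomputable def mahalanobisDist {d : ℕ} (S : Matrix (Fin d) (Fin d) ℝ) (x y : RSpace d) : ℝ :=
  Real.sqrt ((x - y).ofLp ⬝ᵥ (S⁻¹.mulVec (x - y).ofLp))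

/-- The Mahalanobis ellipsoid of `P` of radius `r` about the expectation of `P`. -/
noncomputable def mahalanobisEllipsoid {d : ℕ} (P : Measure (RSpace d)) (r : ℝ) :
    Set (RSpace d) :=
  {x | mahalanobisDist (varianceMatrix P) x (meanVector P) ≤ r}

/-!
For a unit direction of the Mahalanobis geometry, `X = ⟨z - μ, w⟩` with `wᵀ Σ w = 1` has mean `0`,
variance `1` and log-concave tails (`isStandardLogConcave_marginal`), so both kinds of inclusion
reduce to estimates for distributions on the line.

Inner inclusion. If `d_Σ(x, μ) = s`, then `|⟨x - μ, w⟩| ≤ s` by Cauchy-Schwarz, and every halfspace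
containing `x` contains a set `{X ≤ -s}`. Grünbaum's inequality gives `P(X ≤ 0) ≥ 1/e`: with `F` the
distribution function, `-log F(X)` has expectation at most `1`, and Jensen's inequality applies to
the concave function `log F` (`exp_neg_one_le_cdf_zero`). Moreover the density of `X` is at most `1`
(`cdf_le_add`): if `F` had slope `r > 1` at `t`, the one-sided moments of `X - t` would be bounded
by those of the two-sided exponential with the same density and mass on each side, whose variance
is at most `1 / r²`. Therefore `P(X ≤ -s) ≥ 1/e - s`.

Outer inclusions. Taking `w` proportional to `Σ⁻¹ (x - μ)` gives `P(X ≥ d_Σ(x, μ)) ≥ δ`. Chebyshev's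
inequality at the points `-1` and `2` and log-concavity of the tail yield `d_Σ(x, μ) ≤ 4 log (1/δ)`
(`le_four_mul_log_of_le_tail`). It remains to see that `17 L_P ≥ 4`. Borell's theorem
(`exists_isLogConcaveDensity`) gives the whitened measure a log-concave density, so that `L_P` is
not a default value; the density comes from differentiating the measure along balls, and
log-concavity of the measure excludes a singular part. The density `f` is bounded, and integrating
`exp (-‖x‖² / 2)` against it gives `e^(-d/2) ≤ (sup f) (2π)^(d/2)`, that is, `L_P ≥ (2πe)^(-1/2)`.
-/

/-! ### Borell's theorem on densities of log-concave measures -/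

open Filter Topology in
/-- The lower density of `P` at `x` with respect to Lebesgue measure, along the balls of radius
`1 / (n + 1)`. -/
noncomputable def lowerDensity {d : ℕ} (P : Measure (RSpace d)) (x : RSpace d) : ℝ≥0∞ :=
  liminf (fun n : ℕ => P (Metric.closedBall x (1 / ((n : ℝ) + 1))) /
    (volume : Measure (RSpace d)) (Metric.closedBall x (1 / ((n : ℝ) + 1)))) atTop

section LowerDensity

open Filter Topology

variable {d : ℕ} {P : Measure (RSpace d)}

lemma smul_closedBall_add_smul_closedBall_subset (x y : RSpace d) {r t : ℝ} (ht0 : 0 ≤ t)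
    (ht1 : t ≤ 1) :
    t • Metric.closedBall x r + (1 - t) • Metric.closedBall y r ⊆
      Metric.closedBall (t • x + (1 - t) • y) r := by
  rintro _ ⟨_, ⟨a, ha, rfl⟩, _, ⟨b, hb, rfl⟩, rfl⟩
  rw [mem_closedBall_iff_norm] at *
  have h : t • a + (1 - t) • b - (t • x + (1 - t) • y) = t • (a - x) + (1 - t) • (b - y) := by
    module
  simp only
  rw [h]
  refine (norm_add_le _ _).trans ?_
  rw [norm_smul, norm_smul, Real.norm_of_nonneg ht0, Real.norm_of_nonneg (by linarith)]
  nlinarith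

lemma volume_closedBall_pos_ne_top (x : RSpace d) (n : ℕ) :
    (volume : Measure (RSpace d)) (Metric.closedBall x (1 / ((n : ℝ) + 1))) ≠ 0 ∧
      (volume : Measure (RSpace d)) (Metric.closedBall x (1 / ((n : ℝ) + 1))) ≠ ∞ :=
  ⟨(Metric.measure_closedBall_pos _ _ (by positivity)).ne', measure_closedBall_lt_top.ne⟩

/-- Log-concavity of a measure passes to its lower density, because a convex combination of
two balls of radius `r` lies in the ball of radius `r` about the combination of the centres. -/
lemma lowerDensity_rpow_mul_le (hP : IsLogConcaveMeasure P) (x y : RSpace d) {t : ℝ}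
    (ht0 : 0 ≤ t) (ht1 : t ≤ 1) :
    lowerDensity P x ^ t * lowerDensity P y ^ (1 - t) ≤ lowerDensity P (t • x + (1 - t) • y) := by
  have hmono : ∀ s : ℝ, 0 ≤ s → ∀ z, lowerDensity P z ^ s = liminf (fun n : ℕ =>
      (P (Metric.closedBall z (1 / ((n : ℝ) + 1))) /
        (volume : Measure (RSpace d)) (Metric.closedBall z (1 / ((n : ℝ) + 1)))) ^ s) atTop := by
    intro s hs z
    exact Monotone.map_liminf_of_continuousAt (f := fun a : ℝ≥0∞ => a ^ s)
      (ENNReal.monotone_rpow_of_nonneg hs) _ ENNReal.continuous_rpow_const.continuousAt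
  rw [hmono t ht0, hmono (1 - t) (by linarith)]
  refine ENNReal.le_liminf_mul.trans (liminf_le_liminf (Eventually.of_forall fun n => ?_))
  simp only [Pi.mul_apply]
  set r : ℝ := 1 / ((n : ℝ) + 1)
  have hr : 0 ≤ r := by positivity
  have hv : ∀ z w : RSpace d, (volume : Measure (RSpace d)) (Metric.closedBall z r) =
      (volume : Measure (RSpace d)) (Metric.closedBall w r) := fun z w => by
    rw [Measure.addHaar_closedBall_center, Measure.addHaar_closedBall_center _ w]
  rw [hv x (t • x + (1 - t) • y), hv y (t • x + (1 - t) • y)]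
  obtain ⟨hv0, hvt⟩ := volume_closedBall_pos_ne_top (t • x + (1 - t) • y) n
  set v := (volume : Measure (RSpace d)) (Metric.closedBall (t • x + (1 - t) • y) r)
  rw [ENNReal.div_rpow_of_nonneg _ _ ht0, ENNReal.div_rpow_of_nonneg _ _ (by linarith : 0 ≤ 1 - t)]
  calc P (Metric.closedBall x r) ^ t / v ^ t * (P (Metric.closedBall y r) ^ (1 - t) / v ^ (1 - t))
      = P (Metric.closedBall x r) ^ t * P (Metric.closedBall y r) ^ (1 - t) /
          (v ^ t * v ^ (1 - t)) := by
        rw [div_eq_mul_inv, div_eq_mul_inv, div_eq_mul_inv, ENNReal.mul_inv]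
        · ring
        · left; simp [hv0, hvt]
        · left; exact ENNReal.rpow_ne_top_of_nonneg ht0 hvt
    _ = P (Metric.closedBall x r) ^ t * P (Metric.closedBall y r) ^ (1 - t) / v := by
        rw [← ENNReal.rpow_add _ _ hv0 hvt]; simp
    _ ≤ P (Metric.closedBall (t • x + (1 - t) • y) r) / v := by
        gcongr
        exact (hP _ _ measurableSet_closedBall measurableSet_closedBall
          ⟨x, Metric.mem_closedBall_self hr⟩ ⟨y, Metric.mem_closedBall_self hr⟩ t ht0 ht1).trans
          (measure_mono (smul_closedBall_add_smul_closedBall_subset x y ht0 ht1))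

lemma measurable_lowerDensity [IsFiniteMeasure P] : Measurable (lowerDensity P) := by
  have h : ∀ (Q : Measure (RSpace d)) [SFinite Q] (r : ℝ),
      Measurable fun x => Q (Metric.closedBall x r) := by
    intro Q _ r
    have hs : MeasurableSet {p : RSpace d × RSpace d | dist p.2 p.1 ≤ r} :=
      measurableSet_le (by fun_prop) measurable_const
    exact measurable_measure_prodMk_left hs
  exact Measurable.liminf fun n => (h P _).div (h volume _)

lemma tendsto_one_div_succ_nhdsGT : Tendsto (fun n : ℕ => 1 / ((n : ℝ) + 1)) atTop (𝓝[>] 0) :=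
  tendsto_nhdsWithin_iff.2 ⟨tendsto_one_div_add_atTop_nhds_zero_nat,
    Eventually.of_forall fun n => by simp only [Set.mem_Ioi]; positivity⟩

lemma lowerDensity_ae_eq_rnDeriv [IsFiniteMeasure P] :
    lowerDensity P =ᵐ[volume] P.rnDeriv volume := by
  filter_upwards [Besicovitch.ae_tendsto_rnDeriv P volume] with x hx
  exact (hx.comp tendsto_one_div_succ_nhdsGT).liminf_eq

/-- Differentiating Lebesgue measure with respect to `P` describes the lower density at `P`-almost
every point, including those that carry a singular part of `P`. -/
lemma lowerDensity_ae_eq_inv_rnDeriv [IsFiniteMeasure P] :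
    ∀ᵐ x ∂P, lowerDensity P x = ((volume : Measure (RSpace d)).rnDeriv P x)⁻¹ := by
  filter_upwards [Besicovitch.ae_tendsto_rnDeriv (volume : Measure (RSpace d)) P] with x hx
  have h := (continuous_inv.tendsto _).comp (hx.comp tendsto_one_div_succ_nhdsGT)
  rw [← h.liminf_eq]
  refine congrArg (fun u => liminf u atTop) (funext fun n => ?_)
  obtain ⟨hv0, hvt⟩ := volume_closedBall_pos_ne_top x n
  simp only [Function.comp_apply]
  rw [ENNReal.inv_div (Or.inl (measure_ne_top _ _)) (Or.inr hv0)]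

lemma lowerDensity_pos_ae [IsFiniteMeasure P] : ∀ᵐ x ∂P, 0 < lowerDensity P x := by
  filter_upwards [lowerDensity_ae_eq_inv_rnDeriv (P := P),
    Measure.rnDeriv_lt_top (volume : Measure (RSpace d)) P] with x hx hx'
  rw [hx]
  exact ENNReal.inv_pos.2 hx'.ne

lemma convex_lowerDensity_pos (hP : IsLogConcaveMeasure P) :
    Convex ℝ {x | 0 < lowerDensity P x} := by
  intro x hx y hy a b ha hb hab
  obtain rfl : b = 1 - a := by linarith
  refine lt_of_lt_of_le ?_ (lowerDensity_rpow_mul_le hP x y ha (by linarith))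
  exact ENNReal.mul_pos (ENNReal.rpow_pos_of_nonneg hx ha).ne'
    (ENNReal.rpow_pos_of_nonneg hy hb).ne'

end LowerDensity

/-- `P` gives full measure to no affine hyperplane. -/
def NotOnHyperplane {d : ℕ} (P : Measure (RSpace d)) : Prop :=
  ∀ (u : RSpace d) (c : ℝ), u ≠ 0 → ¬ ∀ᵐ z ∂P, inner ℝ z u = c

section Borell

open Filter Topology

variable {d : ℕ} {P : Measure (RSpace d)}

lemma interior_nonempty_of_convex_of_notOnHyperplane [IsProbabilityMeasure P]
    (hnd : NotOnHyperplane P) {S : Set (RSpace d)} (hS : Convex ℝ S) (hPS : ∀ᵐ x ∂P, x ∈ S) :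
    (interior S).Nonempty := by
  rw [hS.interior_nonempty_iff_affineSpan_eq_top]
  by_contra hne
  obtain ⟨p, hp⟩ : S.Nonempty := hPS.exists
  have hp' : p ∈ affineSpan ℝ S := mem_affineSpan ℝ hp
  have hdir : (affineSpan ℝ S).direction ≠ ⊤ := fun h => hne
    ((AffineSubspace.direction_eq_top_iff_of_nonempty ⟨p, hp'⟩).1 h)
  have hort : (affineSpan ℝ S).directionᗮ ≠ ⊥ := fun h => hdir
    (Submodule.orthogonal_eq_bot_iff.1 h)
  obtain ⟨u, hu, hu0⟩ := Submodule.exists_mem_ne_zero_of_ne_bot hort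
  refine hnd u (inner ℝ p u) hu0 ?_
  filter_upwards [hPS] with z hz
  have h := (Submodule.mem_orthogonal _ u).1 hu (z - p)
    (AffineSubspace.vsub_mem_direction (mem_affineSpan ℝ hz) hp')
  rw [inner_sub_left] at h
  linarith

/-- An infinite value of the lower density at one point would spread by log-concavity to the
half-way contraction of the whole support towards that point, a set of positive volume; but the
lower density is a Radon-Nikodym derivative almost everywhere. -/
lemma lowerDensity_ne_top [IsProbabilityMeasure P] (hP : IsLogConcaveMeasure P)
    (hnd : NotOnHyperplane P) (x : RSpace d) : lowerDensity P x ≠ ∞ := by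
  intro hx
  have hint := interior_nonempty_of_convex_of_notOnHyperplane hnd (convex_lowerDensity_pos hP)
    lowerDensity_pos_ae
  have hpos : 0 < (volume : Measure (RSpace d)) {y | 0 < lowerDensity P y} :=
    Measure.measure_pos_of_nonempty_interior _ hint
  have hsub : AffineMap.homothety x (1 / 2 : ℝ) '' {y | 0 < lowerDensity P y} ⊆
      {z | lowerDensity P z = ∞} := by
    rintro _ ⟨y, hy, rfl⟩
    have h := lowerDensity_rpow_mul_le hP x y (t := 1 / 2) (by norm_num) (by norm_num)
    rw [hx, ENNReal.top_rpow_of_pos (by norm_num), ENNReal.top_mul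
      (ENNReal.rpow_pos_of_nonneg hy (by norm_num)).ne', top_le_iff] at h
    rw [Set.mem_ofPred_eq, ← h]
    congr 1
    rw [AffineMap.homothety_apply, vsub_eq_sub, vadd_eq_add]
    module
  have hnull : (volume : Measure (RSpace d)) {z | lowerDensity P z = ∞} = 0 := by
    have : ∀ᵐ z ∂(volume : Measure (RSpace d)), lowerDensity P z ≠ ∞ := by
      filter_upwards [lowerDensity_ae_eq_rnDeriv (P := P),
        Measure.rnDeriv_lt_top P (volume : Measure (RSpace d))] with z hz hz'
      rw [hz]
      exact hz'.ne
    simpa [ae_iff] using this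
  have h0 := measure_mono_null hsub hnull
  rw [Measure.addHaar_image_homothety] at h0
  simp [hpos.ne'] at h0

/-- On a null set the derivative of Lebesgue measure with respect to `P` vanishes `P`-almost
everywhere, so the lower density is infinite there; but it is finite at every point. -/
lemma absolutelyContinuous_of_isLogConcaveMeasure [IsProbabilityMeasure P]
    (hP : IsLogConcaveMeasure P) (hnd : NotOnHyperplane P) :
    P ≪ (volume : Measure (RSpace d)) := by
  refine Measure.AbsolutelyContinuous.mk fun A hA hA0 => ?_
  have h1 : ∫⁻ x in A, (volume : Measure (RSpace d)).rnDeriv P x ∂P = 0 :=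
    le_antisymm ((Measure.setLIntegral_rnDeriv_le A).trans hA0.le) bot_le
  rw [lintegral_eq_zero_iff (Measure.measurable_rnDeriv _ _)] at h1
  have h2 : ∀ᵐ x ∂P.restrict A, False := by
    filter_upwards [h1, ae_restrict_of_ae lowerDensity_ae_eq_inv_rnDeriv] with x hx hx'
    rw [hx, Pi.zero_apply, ENNReal.inv_zero] at hx'
    exact lowerDensity_ne_top hP hnd x hx'
  simpa [ae_iff] using h2

/-- **Borell's theorem**: a log-concave probability measure that is not supported by a hyperplane
has a log-concave density. -/
theorem exists_isLogConcaveDensity [IsProbabilityMeasure P]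
    (hP : IsLogConcaveMeasure P) (hnd : NotOnHyperplane P) :
    ∃ f, IsLogConcaveDensity P f := by
  refine ⟨fun x => (lowerDensity P x).toReal, ⟨fun x => ENNReal.toReal_nonneg, ?_⟩,
    measurable_lowerDensity.ennreal_toReal, ?_⟩
  · intro x y t ht0 ht1
    rw [ENNReal.toReal_rpow, ENNReal.toReal_rpow, ← ENNReal.toReal_mul]
    exact ENNReal.toReal_mono (lowerDensity_ne_top hP hnd _)
      (lowerDensity_rpow_mul_le hP x y ht0 ht1)
  · rw [← Measure.withDensity_rnDeriv_eq P volume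
      (absolutelyContinuous_of_isLogConcaveMeasure hP hnd)]
    refine withDensity_congr_ae ?_
    rw [Measure.withDensity_rnDeriv_eq P volume
      (absolutelyContinuous_of_isLogConcaveMeasure hP hnd)]
    filter_upwards [lowerDensity_ae_eq_rnDeriv (P := P)] with x hx
    rw [ENNReal.ofReal_toReal (lowerDensity_ne_top hP hnd _), hx]

end Borell

/-! ### Log-concave tails on the line -/

/-- The upper tail function `t ↦ ν [t, ∞)` is log-concave. -/
def HasLogConcaveTail (ν : Measure ℝ) : Prop :=
  ∀ s t a : ℝ, 0 ≤ a → a ≤ 1 →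
    ν (Set.Ici s) ^ a * ν (Set.Ici t) ^ (1 - a) ≤ ν (Set.Ici (a * s + (1 - a) * t))

section Tail

open Set

variable {ν : Measure ℝ}

/-- The four-point form of log-concavity: of two pairs with the same sum, the inner one has the
larger product of tails. -/
lemma HasLogConcaveTail.mul_le_mul (hν : HasLogConcaveTail ν) {a b c : ℝ} (hac : a ≤ c)
    (hcb : c ≤ b) : ν (Ici a) * ν (Ici b) ≤ ν (Ici c) * ν (Ici (a + b - c)) := by
  rcases hac.eq_or_lt with rfl | hac'
  · simp
  have hab : 0 < b - a := by linarith
  set θ : ℝ := (b - c) / (b - a) with hθ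
  have hθ0 : 0 ≤ θ := div_nonneg (by linarith) hab.le
  have hθ1 : θ ≤ 1 := (div_le_one hab).2 (by linarith)
  have hc : c = θ * a + (1 - θ) * b := by rw [hθ]; field_simp; ring
  have h1 := hν a b θ hθ0 hθ1
  have h2 := hν a b (1 - θ) (by linarith) (by linarith)
  rw [← hc] at h1
  rw [show (1 - θ) * a + (1 - (1 - θ)) * b = a + b - c by rw [hc]; ring, sub_sub_cancel] at h2
  refine le_trans (le_of_eq ?_) (_root_.mul_le_mul' h1 h2)
  have key : ∀ k : ℝ≥0∞, k ^ θ * k ^ (1 - θ) = k := fun k => by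
    rw [← ENNReal.rpow_add_of_nonneg _ _ hθ0 (by linarith : 0 ≤ 1 - θ)]; simp
  calc ν (Ici a) * ν (Ici b)
      = (ν (Ici a) ^ θ * ν (Ici a) ^ (1 - θ)) * (ν (Ici b) ^ θ * ν (Ici b) ^ (1 - θ)) := by
        rw [key, key]
    _ = _ := by ring

lemma measurable_measure_Ici : Measurable fun x : ℝ => ν (Ici x) :=
  Antitone.measurable fun _ _ h => measure_mono (Ici_subset_Ici.2 h)

lemma lintegral_posPart_eq (t : ℝ) :
    ∫⁻ y, ENNReal.ofReal (max (y - t) 0) ∂ν = ∫⁻ x in Ioi (0 : ℝ), ν (Ici (t + x)) := by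
  rw [lintegral_eq_lintegral_meas_le ν (f := fun y => max (y - t) 0)
    (Filter.Eventually.of_forall fun y => le_max_right _ _)
    (by fun_prop)]
  refine setLIntegral_congr_fun measurableSet_Ioi fun x (hx : 0 < x) => ?_
  congr 1
  ext y
  simp only [mem_ofPred_eq, le_max_iff, mem_Ici]
  constructor
  · rintro (h | h) <;> linarith
  · intro h; left; linarith

lemma lintegral_posPart_sub (c : ℝ) :
    ∫⁻ x in Ioi (0 : ℝ), ENNReal.ofReal (max (c - x) 0) = ENNReal.ofReal (max c 0 ^ 2 / 2) := by
  rcases le_or_gt c 0 with hc | hc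
  · rw [max_eq_right hc, setLIntegral_congr_fun (g := fun _ => 0) measurableSet_Ioi]
    · simp
    · intro x (hx : 0 < x)
      simp only
      rw [max_eq_right (by linarith), ENNReal.ofReal_zero]
  · have h1 : ∫⁻ x in Ioi (0 : ℝ), ENNReal.ofReal (max (c - x) 0) =
        ∫⁻ x in Ioc (0 : ℝ) c, ENNReal.ofReal (c - x) := by
      rw [← lintegral_indicator measurableSet_Ioi, ← lintegral_indicator measurableSet_Ioc]
      congr 1
      ext x
      by_cases h0 : 0 < x
      · by_cases hxc : x ≤ c
        · rw [indicator_of_mem (mem_Ioi.2 h0), indicator_of_mem (mem_Ioc.2 ⟨h0, hxc⟩),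
            max_eq_left (by linarith)]
        · rw [indicator_of_mem (mem_Ioi.2 h0), indicator_of_notMem (fun h => hxc h.2),
            max_eq_right (by linarith), ENNReal.ofReal_zero]
      · rw [indicator_of_notMem (by simpa using h0), indicator_of_notMem (fun h => h0 h.1)]
    rw [h1, max_eq_left hc.le, ← ofReal_integral_eq_lintegral_ofReal,
      ← intervalIntegral.integral_of_le hc.le]
    · congr 1
      rw [intervalIntegral.integral_sub (by simp) (by simp)]
      simp
      ring
    · exact (Continuous.integrableOn_Icc (by fun_prop)).mono_set Ioc_subset_Icc_self
    · refine (ae_restrict_iff' measurableSet_Ioc).2 (Filter.Eventually.of_forall fun x hx => ?_)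
      simpa using hx.2

/-- The second moment of `(X - t)₊` as a double integral of the tail: a layer-cake formula applied
once more to `E[(X - t - x)₊]`. -/
lemma lintegral_posPart_sq_eq [SFinite ν] (t : ℝ) :
    ∫⁻ y, ENNReal.ofReal (max (y - t) 0 ^ 2 / 2) ∂ν =
      ∫⁻ x in Ioi (0 : ℝ), ∫⁻ y in Ioi (0 : ℝ), ν (Ici (t + x + y)) := by
  simp_rw [← lintegral_posPart_eq, ← lintegral_posPart_sub]
  rw [lintegral_lintegral_swap]
  · simp_rw [sub_sub]
  · exact Measurable.aemeasurable (by fun_prop)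

/-- For a log-concave tail, `P(X ≥ t) E[(X - t)₊²] ≤ 2 (E[(X - t)₊])²`. -/
lemma HasLogConcaveTail.mul_lintegral_sq_le [SFinite ν] (hν : HasLogConcaveTail ν) (t : ℝ) :
    ν (Ici t) * ∫⁻ y, ENNReal.ofReal (max (y - t) 0 ^ 2 / 2) ∂ν ≤
      (∫⁻ y, ENNReal.ofReal (max (y - t) 0) ∂ν) ^ 2 := by
  rw [lintegral_posPart_sq_eq, lintegral_posPart_eq]
  have hm : ∀ c : ℝ, Measurable fun x : ℝ => ν (Ici (c + x)) := fun c =>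
    measurable_measure_Ici.comp (measurable_const.add measurable_id)
  have hm2 : Measurable fun x : ℝ => ∫⁻ y in Ioi (0 : ℝ), ν (Ici (t + x + y)) := by
    refine Measurable.lintegral_prod_right' (f := fun p : ℝ × ℝ => ν (Ici (t + p.1 + p.2))) ?_
    exact measurable_measure_Ici.comp (by fun_prop)
  rw [← lintegral_const_mul _ hm2, sq, ← lintegral_mul_const _ (hm t)]
  refine setLIntegral_mono (by exact (hm t).mul_const _) fun x (hx : 0 < x) => ?_
  rw [← lintegral_const_mul _ (hm _), ← lintegral_const_mul _ (hm _)]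
  refine setLIntegral_mono ((hm t).const_mul _) fun y (hy : 0 < y) => ?_
  have h := hν.mul_le_mul (a := t) (b := t + x + y) (c := t + x) (by linarith) (by linarith)
  rwa [show t + (t + x + y) - (t + x) = t + y by ring] at h

/-- The hazard rate `P(X ≥ t) / E[(X - t)₊]` of a log-concave tail is nondecreasing. -/
lemma HasLogConcaveTail.mul_integral_posPart_le [IsFiniteMeasure ν] (hν : HasLogConcaveTail ν)
    (hint : ∀ t, Integrable (fun y => max (y - t) 0) ν) (t : ℝ) {h : ℝ} (hh : 0 < h) :
    ν.real (Ici t) * ∫ y, max (y - (t + h)) 0 ∂ν ≤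
      ν.real (Ici (t + h)) * ∫ y, max (y - t) 0 ∂ν := by
  have hE : ∀ t, ENNReal.ofReal (∫ y, max (y - t) 0 ∂ν) = ∫⁻ x in Ioi (0 : ℝ), ν (Ici (t + x)) :=
    fun t => by
      rw [ofReal_integral_eq_lintegral_ofReal (hint t)
        (Filter.Eventually.of_forall fun y => le_max_right _ _), lintegral_posPart_eq]
  have hI0 : ∀ t, 0 ≤ ∫ y, max (y - t) 0 ∂ν := fun t => integral_nonneg fun y => le_max_right _ _
  have hm : ∀ c : ℝ, Measurable fun x : ℝ => ν (Ici (c + x)) := fun c =>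
    measurable_measure_Ici.comp (measurable_const.add measurable_id)
  have h1 : ν (Ici t) * ∫⁻ x in Ioi (0 : ℝ), ν (Ici (t + h + x)) ≤
      ν (Ici (t + h)) * ∫⁻ x in Ioi (0 : ℝ), ν (Ici (t + x)) := by
    rw [← lintegral_const_mul _ (hm _), ← lintegral_const_mul _ (hm _)]
    refine setLIntegral_mono ((hm t).const_mul _) fun y (hy : 0 < y) => ?_
    have h4 := hν.mul_le_mul (a := t) (b := t + h + y) (c := t + h) (by linarith) (by linarith)
    rwa [show t + (t + h + y) - (t + h) = t + y by ring] at h4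
  rw [← hE, ← hE] at h1
  have h1' := ENNReal.toReal_mono (by finiteness) h1
  simpa only [ENNReal.toReal_mul, ENNReal.toReal_ofReal (hI0 _), ← measureReal_def] using h1'

lemma integral_posPart_le_add [IsFiniteMeasure ν]
    (hint : ∀ t, Integrable (fun y => max (y - t) 0) ν) (t : ℝ) {h : ℝ} (hh : 0 < h) :
    ∫ y, max (y - t) 0 ∂ν ≤ h * ν.real (Ici t) + ∫ y, max (y - (t + h)) 0 ∂ν := by
  have hi : Integrable (fun y => h * (Ici t).indicator (fun _ => (1 : ℝ)) y) ν :=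
    ((integrable_const 1).indicator measurableSet_Ici).const_mul h
  have h1 : h * ν.real (Ici t) = ∫ y, h * (Ici t).indicator (fun _ => (1 : ℝ)) y ∂ν := by
    rw [integral_const_mul, integral_indicator measurableSet_Ici]
    simp
  rw [h1, ← integral_add hi (hint _)]
  refine integral_mono (hint _) (hi.add (hint _)) fun y => ?_
  simp only
  by_cases hy : t ≤ y
  · rw [indicator_of_mem (mem_Ici.2 hy)]
    rcases max_cases (y - t) 0 with h3 | h3 <;> rcases max_cases (y - (t + h)) 0 with h4 | h4 <;>
      nlinarith
  · rw [indicator_of_notMem (by simpa using hy), max_eq_right (by linarith)]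
    positivity

/-- If the tail drops from `t` to `t + h` with slope at least `r`, then
`r E[(X - t)₊] ≤ P(X ≥ t)²`, as for an exponential tail. -/
lemma HasLogConcaveTail.mul_integral_le_of_drop [IsFiniteMeasure ν] (hν : HasLogConcaveTail ν)
    (hint : ∀ t, Integrable (fun y => max (y - t) 0) ν) {t h r : ℝ} (hh : 0 < h)
    (hdrop : ν.real (Ici (t + h)) ≤ ν.real (Ici t) - r * h) :
    r * ∫ y, max (y - t) 0 ∂ν ≤ ν.real (Ici t) ^ 2 := by
  have hA : 0 ≤ ∫ y, max (y - t) 0 ∂ν := integral_nonneg fun y => le_max_right _ _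
  have h1 := hν.mul_integral_posPart_le hint t hh
  have h2 := mul_le_mul_of_nonneg_left (integral_posPart_le_add hint t hh)
    (measureReal_nonneg (μ := ν) (s := Ici t))
  have h3 := mul_le_mul_of_nonneg_right hdrop hA
  refine le_of_mul_le_mul_left ?_ hh
  nlinarith

/-- If the tail drops from `t - h` to `t` with slope at least `r`, then
`r E[(X - t)₊] ≤ P(X ≥ t) P(X ≥ t - h)`. -/
lemma HasLogConcaveTail.mul_integral_le_of_rise [IsFiniteMeasure ν] (hν : HasLogConcaveTail ν)
    (hint : ∀ t, Integrable (fun y => max (y - t) 0) ν) {t h r : ℝ} (hh : 0 < h)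
    (hrise : ν.real (Ici t) + r * h ≤ ν.real (Ici (t - h))) :
    r * ∫ y, max (y - t) 0 ∂ν ≤ ν.real (Ici t) * ν.real (Ici (t - h)) := by
  have hB : 0 ≤ ∫ y, max (y - t) 0 ∂ν := integral_nonneg fun y => le_max_right _ _
  have h1 := hν.mul_integral_posPart_le hint (t - h) hh
  have h2 := integral_posPart_le_add hint (t - h) hh
  rw [sub_add_cancel] at h1 h2
  have h2' := mul_le_mul_of_nonneg_left h2 (measureReal_nonneg (μ := ν) (s := Ici t))
  have h3 := mul_le_mul_of_nonneg_right hrise hB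
  refine le_of_mul_le_mul_left ?_ hh
  nlinarith

end Tail

/-! ### The density of a standard log-concave distribution -/

/-- An atomless distribution on the line with mean `0` and variance `1`, both of whose tails are
log-concave. -/
structure IsStandardLogConcave (ν : Measure ℝ) : Prop where
  tail : HasLogConcaveTail ν
  tail_neg : HasLogConcaveTail (ν.map Neg.neg)
  integrable_sq : Integrable (fun y => y ^ 2) ν
  mean : ∫ y, y ∂ν = 0
  second : ∫ y, y ^ 2 ∂ν = 1
  nullSingleton : NullSingletonClass ν

section Standard

open Set Filter Topology

variable {ν : Measure ℝ}

lemma map_neg_real_Ici (s : ℝ) : (ν.map Neg.neg).real (Ici s) = ν.real (Iic (-s)) := by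
  rw [measureReal_def, measureReal_def, Measure.map_apply measurable_neg measurableSet_Ici]
  congr 2
  ext x
  simp only [mem_preimage, mem_Ici, mem_Iic]
  constructor <;> intro h <;> linarith

lemma integral_negPart (t : ℝ) :
    ∫ y, max (y - t) 0 ∂(ν.map Neg.neg) = ∫ y, max (-t - y) 0 ∂ν := by
  rw [integral_map measurable_neg.aemeasurable (by fun_prop)]
  refine integral_congr_ae (Eventually.of_forall fun y => ?_)
  simp only
  congr 1; ring

lemma integral_negPart_sq (t : ℝ) :
    ∫ y, max (y - t) 0 ^ 2 ∂(ν.map Neg.neg) = ∫ y, max (-t - y) 0 ^ 2 ∂ν := by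
  rw [integral_map measurable_neg.aemeasurable (by fun_prop)]
  refine integral_congr_ae (Eventually.of_forall fun y => ?_)
  simp only
  congr 2; ring

lemma HasLogConcaveTail.mul_integral_sq_le [IsProbabilityMeasure ν]
    (hν : HasLogConcaveTail ν)
    (hint : ∀ t, Integrable (fun y => max (y - t) 0) ν)
    (hint2 : ∀ t, Integrable (fun y => max (y - t) 0 ^ 2) ν) (t : ℝ) :
    ν.real (Ici t) * ((∫ y, max (y - t) 0 ^ 2 ∂ν) / 2) ≤ (∫ y, max (y - t) 0 ∂ν) ^ 2 := by
  have h := hν.mul_lintegral_sq_le t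
  rw [← ofReal_integral_eq_lintegral_ofReal (hint t)
      (Eventually.of_forall fun y => le_max_right _ _),
    ← ofReal_integral_eq_lintegral_ofReal ((hint2 t).div_const 2)
      (Eventually.of_forall fun y => by simp only [Pi.zero_apply]; positivity),
    integral_div] at h
  have h' := ENNReal.toReal_mono (by finiteness) h
  rwa [ENNReal.toReal_mul, ENNReal.toReal_pow, ENNReal.toReal_ofReal
    (show 0 ≤ ∫ y, max (y - t) 0 ∂ν from integral_nonneg fun y => le_max_right _ _),
    ENNReal.toReal_ofReal
    (div_nonneg (integral_nonneg fun y => by positivity) zero_le_two)] at h'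

/-- Comparison with the two-sided exponential: if the upper mass `q` and lower mass `p` of a
distribution give first moments at most `q² / r` and `p² / r` with `r > 1`, and each one-sided
second moment obeys the log-concave bound, then the variance is less than `1`. The bound `h₂` is
void for `p = 0`, where `S₂ = 0` is assumed instead. -/
lemma false_of_moment_bounds {p q A B S₁ S₂ r : ℝ} (hq : 0 < q) (hp : 0 ≤ p) (hpq : p + q = 1)
    (hA0 : 0 ≤ A) (hB0 : 0 ≤ B) (hr : 1 < r) (hA : r * A ≤ q ^ 2) (hB : r * B ≤ p ^ 2)
    (h₁ : q * (S₁ / 2) ≤ A ^ 2) (h₂ : p * (S₂ / 2) ≤ B ^ 2) (h0 : p = 0 → S₂ = 0)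
    (hS : S₁ + S₂ = 1 + (A - B) ^ 2) : False := by
  rcases hp.eq_or_lt with rfl | hp
  · obtain rfl : q = 1 := by linarith
    rw [h0 rfl] at hS
    have : B = 0 := by nlinarith
    subst this
    nlinarith
  -- `a` and `b` compare the one-sided first moments with those of exponentials of unit density.
  obtain ⟨a, rfl⟩ : ∃ a, A = a * q ^ 2 := ⟨A / q ^ 2, by field_simp⟩
  obtain ⟨b, rfl⟩ : ∃ b, B = b * p ^ 2 := ⟨B / p ^ 2, by field_simp⟩
  have ha0 : 0 ≤ a := nonneg_of_mul_nonneg_left hA0 (by positivity)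
  have hb0 : 0 ≤ b := nonneg_of_mul_nonneg_left hB0 (by positivity)
  have ha : r * a ≤ 1 := le_of_mul_le_mul_right (by linarith) (by positivity : 0 < q ^ 2)
  have hb : r * b ≤ 1 := le_of_mul_le_mul_right (by linarith) (by positivity : 0 < p ^ 2)
  have hS₁ : S₁ ≤ 2 * a ^ 2 * q ^ 3 := le_of_mul_le_mul_left (by nlinarith) hq
  have hS₂ : S₂ ≤ 2 * b ^ 2 * p ^ 3 := le_of_mul_le_mul_left (by nlinarith) hp
  have ha1 : a < 1 := by nlinarith
  have hb1 : b < 1 := by nlinarith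
  have hp1 : p < 1 := by linarith
  have hq1 : q < 1 := by linarith
  have e1 : a ^ 2 * (2 * q ^ 3 - q ^ 4) ≤ 2 * q ^ 3 - q ^ 4 := by
    have : 0 ≤ 2 * q ^ 3 - q ^ 4 := by nlinarith [pow_pos hq 3]
    exact mul_le_of_le_one_left this (pow_le_one₀ ha0 ha1.le)
  have e2 : b ^ 2 * (2 * p ^ 3 - p ^ 4) ≤ 2 * p ^ 3 - p ^ 4 := by
    have : 0 ≤ 2 * p ^ 3 - p ^ 4 := by nlinarith [pow_pos hp 3]
    exact mul_le_of_le_one_left this (pow_le_one₀ hb0 hb1.le)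
  have e3 : a * b * (p ^ 2 * q ^ 2) ≤ p ^ 2 * q ^ 2 := by
    have : 0 ≤ p ^ 2 * q ^ 2 := by positivity
    exact mul_le_of_le_one_left this (mul_le_one₀ ha1.le hb0 hb1.le)
  have e4 : 2 * q ^ 3 - q ^ 4 + (2 * p ^ 3 - p ^ 4) + 2 * (p ^ 2 * q ^ 2) = 1 - 2 * (p * q) := by
    obtain rfl : q = 1 - p := by linarith
    ring
  have e5 : 0 < p * q := mul_pos hp hq
  nlinarith

namespace IsStandardLogConcave

lemma memLp (h : IsStandardLogConcave ν) : MemLp (fun y => y) 2 ν :=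
  (memLp_two_iff_integrable_sq measurable_id.aestronglyMeasurable).2 h.integrable_sq

variable [IsProbabilityMeasure ν]

lemma integrable_id (h : IsStandardLogConcave ν) : Integrable (fun y => y) ν :=
  h.memLp.integrable one_le_two

lemma memLp_posPart (h : IsStandardLogConcave ν) (t : ℝ) :
    MemLp (fun y => max (y - t) 0) 2 ν :=
  (h.memLp.sub (memLp_const t)).pos_part

lemma memLp_negPart (h : IsStandardLogConcave ν) (t : ℝ) :
    MemLp (fun y => max (t - y) 0) 2 ν :=
  ((memLp_const t).sub h.memLp).pos_part

lemma real_Ici (h : IsStandardLogConcave ν) (t : ℝ) : ν.real (Ici t) = 1 - ν.real (Iic t) := by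
  have := h.nullSingleton
  rw [← probReal_compl_eq_one_sub measurableSet_Iic, compl_Iic]
  exact (measureReal_congr Ioi_ae_eq_Ici).symm

lemma continuous_cdf (h : IsStandardLogConcave ν) : Continuous fun t => ν.real (Iic t) := by
  have hc : (fun t => ν.real (Iic t)) = cdf ν := by ext t; rw [cdf_eq_real]
  rw [hc, continuous_iff_continuousAt]
  intro x
  rw [(monotone_cdf ν).continuousAt_iff_leftLim_eq_rightLim, (cdf ν).rightLim_eq]
  have h1 := (cdf ν).measure_singleton x
  have := h.nullSingleton
  rw [measure_cdf, measure_singleton, eq_comm, ENNReal.ofReal_eq_zero] at h1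
  exact le_antisymm ((monotone_cdf ν).leftLim_le le_rfl) (by linarith)

/-- The density of a standard log-concave distribution is at most `1`, stated through the right
difference quotients of the distribution function. -/
lemma not_eventually_slope_ge (h : IsStandardLogConcave ν) (t : ℝ) {r : ℝ} (hr : 1 < r) :
    ¬ ∀ᶠ z in 𝓝[>] t, ν.real (Iic t) + r * (z - t) ≤ ν.real (Iic z) := by
  intro hev
  -- Close to `t` the value of the distribution function is within the factor `2r / (1 + r)`,
  -- which costs part of the slope `r` but leaves the slope `(1 + r) / 2 > 1`.
  have hcont : ∀ᶠ z in 𝓝[>] t, 0 < ν.real (Iic t) →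
      ν.real (Iic z) * ((1 + r) / 2) ≤ ν.real (Iic t) * r := by
    by_cases hp : 0 < ν.real (Iic t)
    · have h1 : ∀ᶠ z in 𝓝 t, ν.real (Iic z) * ((1 + r) / 2) < ν.real (Iic t) * r :=
        (h.continuous_cdf.mul continuous_const).continuousAt.eventually_lt_const (by
          change ν.real (Iic t) * ((1 + r) / 2) < ν.real (Iic t) * r
          nlinarith)
      filter_upwards [nhdsWithin_le_nhds h1] with z hz _ using hz.le
    · exact Eventually.of_forall fun z hz => absurd hz hp
  obtain ⟨z, ⟨hz1, hz2⟩, (hz3 : t < z)⟩ := ((hev.and hcont).and self_mem_nhdsWithin).exists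
  have hh : 0 < z - t := by linarith
  have hint : ∀ s, Integrable (fun y => max (y - s) 0) ν := fun s =>
    (h.memLp_posPart s).integrable one_le_two
  have : IsProbabilityMeasure (ν.map Neg.neg) :=
    Measure.isProbabilityMeasure_map measurable_neg.aemeasurable
  have hmem' : ∀ s, MemLp (fun y => max (y - s) 0) 2 (ν.map Neg.neg) := fun s => by
    rw [memLp_map_measure_iff (by fun_prop) measurable_neg.aemeasurable]
    convert h.memLp_negPart (-s) using 2 with y
    simp only [Function.comp_apply]
    congr 1; ring
  have hint' : ∀ s, Integrable (fun y => max (y - s) 0) (ν.map Neg.neg) := fun s =>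
    (hmem' s).integrable one_le_two
  have hA := h.tail.mul_integral_le_of_drop hint (t := t) (r := r) hh (by
    rw [h.real_Ici, h.real_Ici, add_sub_cancel]; linarith)
  -- The reflected distribution has tail `F(t)` at `-t` and tail `F(z)` at `-z`.
  have hB := h.tail_neg.mul_integral_le_of_rise hint' (t := -t) (r := r) hh (by
    rw [map_neg_real_Ici, map_neg_real_Ici, neg_neg, show -(-t - (z - t)) = z by ring]
    exact hz1)
  rw [map_neg_real_Ici, map_neg_real_Ici, neg_neg, show -(-t - (z - t)) = z by ring,
    integral_negPart, neg_neg] at hB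
  have h₁ := h.tail.mul_integral_sq_le hint (fun s => (h.memLp_posPart s).integrable_sq) t
  have h₂ := h.tail_neg.mul_integral_sq_le hint' (fun s => (hmem' s).integrable_sq) (-t)
  rw [map_neg_real_Ici, integral_negPart, integral_negPart_sq, neg_neg] at h₂
  have hmean : ∫ y, max (y - t) 0 ∂ν - ∫ y, max (t - y) 0 ∂ν = -t := by
    rw [← integral_sub (hint t) ((h.memLp_negPart t).integrable one_le_two)]
    have : ∀ y : ℝ, max (y - t) 0 - max (t - y) 0 = y - t := fun y => by
      rcases le_total y t with hy | hy
      · rw [max_eq_right (by linarith), max_eq_left (by linarith)]; ring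
      · rw [max_eq_left (by linarith), max_eq_right (by linarith)]; ring
    simp_rw [this]
    rw [integral_sub h.integrable_id (integrable_const _), h.mean]
    simp
  have hsq : ∫ y, max (y - t) 0 ^ 2 ∂ν + ∫ y, max (t - y) 0 ^ 2 ∂ν = 1 + t ^ 2 := by
    rw [← integral_add (h.memLp_posPart t).integrable_sq (h.memLp_negPart t).integrable_sq]
    have : ∀ y : ℝ, max (y - t) 0 ^ 2 + max (t - y) 0 ^ 2 = y ^ 2 + (-2 * t * y + t ^ 2) :=
      fun y => by
        rcases le_total y t with hy | hy
        · rw [max_eq_right (by linarith), max_eq_left (by linarith)]; ring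
        · rw [max_eq_left (by linarith), max_eq_right (by linarith)]; ring
    simp_rw [this]
    have hi : Integrable (fun y => -2 * t * y) ν := h.integrable_id.const_mul _
    have hi' : Integrable (fun y => -2 * t * y + t ^ 2) ν := hi.add (integrable_const _)
    rw [integral_add h.integrable_sq hi', integral_add hi (integrable_const _),
      integral_const_mul, h.mean, h.second]
    simp
  have hp0 : ν.real (Iic t) = 0 → ∫ y, max (t - y) 0 ^ 2 ∂ν = 0 := by
    intro hp
    rw [measureReal_eq_zero_iff] at hp
    refine integral_eq_zero_of_ae ?_
    filter_upwards [measure_eq_zero_iff_ae_notMem.1 hp] with y hy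
    rw [max_eq_right (by simp only [mem_Iic, not_le] at hy; linarith)]
    simp
  have hz : ν.real (Iic z) ≤ 1 := measureReal_le_one
  rw [h.real_Ici] at hA h₁
  have hp : 0 ≤ ν.real (Iic t) := measureReal_nonneg
  have hB0 : 0 ≤ ∫ y, max (t - y) 0 ∂ν := integral_nonneg fun y => le_max_right _ _
  have hA0 : 0 ≤ ∫ y, max (y - t) 0 ∂ν := integral_nonneg fun y => le_max_right _ _
  refine false_of_moment_bounds (q := 1 - ν.real (Iic t)) (p := ν.real (Iic t)) (r := (1 + r) / 2)
    (by nlinarith) hp (by ring) hA0 hB0 (by linarith) (by nlinarith) ?_ h₁ h₂ hp0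
    (by rw [hsq, hmean]; ring)
  rcases hp.eq_or_lt with h0 | h0
  · rw [← h0] at hB ⊢
    nlinarith
  · have h3 := mul_le_mul_of_nonneg_left (hz2 h0) hp
    have h4 := mul_le_mul_of_nonneg_right hB (by linarith : 0 ≤ (1 + r) / 2)
    refine le_of_mul_le_mul_left ?_ (by linarith : 0 < r)
    nlinarith

/-- A standard log-concave distribution gives mass at most `b - a` to an interval `(a, b]`. -/
lemma cdf_le_add (h : IsStandardLogConcave ν) {a b : ℝ} (hab : a ≤ b) :
    ν.real (Iic b) ≤ ν.real (Iic a) + (b - a) := by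
  refine image_le_of_liminf_slope_right_le_deriv_boundary (f := fun t => ν.real (Iic t))
    (B := fun x => ν.real (Iic a) + (x - a)) (B' := fun _ => 1) h.continuous_cdf.continuousOn
    (by simp) (by fun_prop) (fun x _ => ?_) (fun x _ r hr => ?_) (right_mem_Icc.2 hab)
  · exact (((hasDerivAt_id x).sub_const a).const_add _).hasDerivWithinAt
  · by_contra hcon
    rw [not_frequently] at hcon
    refine h.not_eventually_slope_ge x hr ?_
    filter_upwards [hcon, self_mem_nhdsWithin] with z hz (hxz : x < z)
    rw [not_lt, slope_def_field, le_div_iff₀ (by linarith)] at hz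
    linarith

end IsStandardLogConcave

end Standard

/-! ### Grünbaum's inequality and tail decay -/

section Grunbaum

open Set Filter Topology

lemma ConcaveOn.exists_affine_ge_of_mem_interior {S : Set ℝ} {f : ℝ → ℝ} {x : ℝ}
    (hf : ConcaveOn ℝ S f) (hx : x ∈ interior S) :
    ∃ c, ∀ y ∈ S, f y ≤ f x + c * (y - x) := by
  have hg := hf.neg
  refine ⟨-derivWithin (-f) (Ioi x) x, fun y hy => ?_⟩
  rcases lt_trichotomy x y with hxy | rfl | hxy
  · have h := hg.rightDeriv_le_slope_of_mem_interior hx hy hxy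
    rw [slope_def_field, le_div_iff₀ (by linarith)] at h
    simp only [Pi.neg_apply] at h
    linarith
  · simp
  · have h := (hg.slope_le_leftDeriv_of_mem_interior hy hx hxy).trans
      (hg.leftDeriv_le_rightDeriv_of_mem_interior hx)
    rw [slope_def_field, div_le_iff₀ (by linarith)] at h
    simp only [Pi.neg_apply] at h
    linarith

lemma measure_cdf_lt_le {ν : Measure ℝ} [IsProbabilityMeasure ν] (u : ℝ) :
    ν {x | ν.real (Iic x) < u} ≤ ENNReal.ofReal u := by
  have hmono : Monotone fun x => ν.real (Iic x) := fun x y h =>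
    measureReal_mono (Iic_subset_Iic.2 h)
  have hmeas : MeasurableSet {x | ν.real (Iic x) < u} :=
    measurableSet_lt hmono.measurable measurable_const
  rw [hmeas.measure_eq_iSup_isCompact_of_ne_top (measure_ne_top _ _)]
  refine iSup₂_le fun K hKS => iSup_le fun hK => ?_
  rcases K.eq_empty_or_nonempty with rfl | hne
  · simp
  have hmem := hK.sSup_mem hne
  calc ν K ≤ ν (Iic (sSup K)) := measure_mono fun y hy => le_csSup hK.bddAbove hy
    _ ≤ ENNReal.ofReal u := by
      rw [← ofReal_measureReal]
      exact ENNReal.ofReal_le_ofReal (hKS hmem).le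

lemma cdf_pos_ae {ν : Measure ℝ} [IsProbabilityMeasure ν] : ∀ᵐ x ∂ν, 0 < ν.real (Iic x) := by
  have h : ∀ ε : ℝ, 0 < ε → ν {x | ¬ 0 < ν.real (Iic x)} ≤ ENNReal.ofReal ε := fun ε hε =>
    (measure_mono fun x hx => lt_of_le_of_lt (not_lt.1 hx) hε).trans (measure_cdf_lt_le ε)
  rw [ae_iff]
  refine le_antisymm (ENNReal.le_of_forall_pos_le_add fun ε hε _ => ?_) bot_le
  rw [zero_add]
  simpa using h ε hε

/-- `F(X)` stochastically dominates a uniform variable, so `-log F(X)` is dominated by a standard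
exponential one. -/
lemma lintegral_neg_log_cdf_le {ν : Measure ℝ} [IsProbabilityMeasure ν] :
    ∫⁻ x, ENNReal.ofReal (-Real.log (ν.real (Iic x))) ∂ν ≤ 1 := by
  have hmono : Monotone fun x => ν.real (Iic x) := fun x y h =>
    measureReal_mono (Iic_subset_Iic.2 h)
  rw [lintegral_eq_lintegral_meas_lt ν (f := fun x => -Real.log (ν.real (Iic x)))
    (Eventually.of_forall fun x => ?_) (hmono.measurable.log.neg.aemeasurable)]
  · calc ∫⁻ s in Ioi (0 : ℝ), ν {x | s < -Real.log (ν.real (Iic x))}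
        ≤ ∫⁻ s in Ioi (0 : ℝ), ENNReal.ofReal (Real.exp (-s)) := by
          refine lintegral_mono fun s => ?_
          refine le_trans (measure_mono_ae ?_) (measure_cdf_lt_le _)
          filter_upwards [cdf_pos_ae (ν := ν)] with x hx hs
          change s < -Real.log (ν.real (Iic x)) at hs
          change ν.real (Iic x) < Real.exp (-s)
          rw [← Real.log_lt_iff_lt_exp hx]
          linarith
      _ = 1 := by
          rw [← ofReal_integral_eq_lintegral_ofReal
            (integrableOn_exp_neg_Ioi 0)
            (Eventually.of_forall fun s => (Real.exp_pos _).le), integral_exp_neg_Ioi_zero]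
          simp
  · simp only [Pi.zero_apply, Left.nonneg_neg_iff]
    exact Real.log_nonpos measureReal_nonneg measureReal_le_one

namespace IsStandardLogConcave

variable {ν : Measure ℝ} [IsProbabilityMeasure ν]

lemma rpow_mul_cdf_le (h : IsStandardLogConcave ν) (s t : ℝ) {a : ℝ} (ha0 : 0 ≤ a) (ha1 : a ≤ 1) :
    ν.real (Iic s) ^ a * ν.real (Iic t) ^ (1 - a) ≤ ν.real (Iic (a * s + (1 - a) * t)) := by
  have : IsProbabilityMeasure (ν.map Neg.neg) :=
    Measure.isProbabilityMeasure_map measurable_neg.aemeasurable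
  have h1 := ENNReal.toReal_mono (measure_ne_top _ _) (h.tail_neg (-s) (-t) a ha0 ha1)
  rw [ENNReal.toReal_mul, ← ENNReal.toReal_rpow, ← ENNReal.toReal_rpow, ← measureReal_def,
    ← measureReal_def, ← measureReal_def, map_neg_real_Ici, map_neg_real_Ici, map_neg_real_Ici,
    neg_neg, neg_neg] at h1
  convert h1 using 3
  ring

lemma concaveOn_log_cdf (h : IsStandardLogConcave ν) :
    ConcaveOn ℝ {t | 0 < ν.real (Iic t)} fun t => Real.log (ν.real (Iic t)) := by
  have key : ∀ {s t a b : ℝ}, 0 < ν.real (Iic s) → 0 < ν.real (Iic t) → 0 ≤ a → 0 ≤ b →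
      a + b = 1 → 0 < ν.real (Iic s) ^ a * ν.real (Iic t) ^ b ∧
        ν.real (Iic s) ^ a * ν.real (Iic t) ^ b ≤ ν.real (Iic (a * s + b * t)) := by
    intro s t a b hs ht ha hb hab
    obtain rfl : b = 1 - a := by linarith
    exact ⟨by positivity, h.rpow_mul_cdf_le s t ha (by linarith)⟩
  refine ⟨fun s hs t ht a b ha hb hab => ?_, fun s hs t ht a b ha hb hab => ?_⟩
  · obtain ⟨h1, h2⟩ := key hs ht ha hb hab
    exact h1.trans_le h2
  · obtain ⟨h1, h2⟩ := key hs ht ha hb hab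
    have hs' : 0 < ν.real (Iic s) := hs
    have ht' : 0 < ν.real (Iic t) := ht
    have h3 := Real.log_le_log h1 h2
    rw [Real.log_mul (by positivity) (by positivity), Real.log_rpow hs', Real.log_rpow ht'] at h3
    exact h3

/-- The mean `0` is an interior point of the domain of `log F`, as the distribution is not
concentrated at its mean. -/
lemma exists_neg_cdf_pos (h : IsStandardLogConcave ν) : ∃ s < 0, 0 < ν.real (Iic s) := by
  by_contra! hcon
  have h0 : ν (Iio 0) = 0 := by
    have hU : Iio (0 : ℝ) = ⋃ n : ℕ, Iic (-(1 / ((n : ℝ) + 1))) := by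
      ext x
      simp only [mem_Iio, mem_iUnion, mem_Iic]
      constructor
      · intro hx
        obtain ⟨n, hn⟩ := exists_nat_one_div_lt (neg_pos.2 hx)
        exact ⟨n, by linarith⟩
      · rintro ⟨n, hn⟩
        have : 0 < 1 / ((n : ℝ) + 1) := by positivity
        linarith
    rw [hU]
    refine measure_iUnion_null fun n => ?_
    have : 0 < 1 / ((n : ℝ) + 1) := by positivity
    exact (measureReal_eq_zero_iff (measure_ne_top _ _)).1
      (le_antisymm (hcon _ (by linarith)) measureReal_nonneg)
  have hnn : 0 ≤ᵐ[ν] fun y => y := by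
    filter_upwards [measure_eq_zero_iff_ae_notMem.1 h0] with y hy
    simpa using hy
  have hz := (integral_eq_zero_iff_of_nonneg_ae hnn h.integrable_id).1 h.mean
  have : ∫ y, y ^ 2 ∂ν = 0 := integral_eq_zero_of_ae (by
    filter_upwards [hz] with y hy
    simp only [Pi.zero_apply] at hy
    simp [hy])
  rw [h.second] at this
  exact one_ne_zero this

/-- **Grünbaum's inequality**: Jensen's inequality for the concave function `log F`, together with
`E[-log F(X)] ≤ 1`, gives `log F(0) ≥ -1` at the mean `0`. -/
theorem exp_neg_one_le_cdf_zero (h : IsStandardLogConcave ν) :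
    Real.exp (-1) ≤ ν.real (Iic 0) := by
  obtain ⟨s, hs0, hs⟩ := h.exists_neg_cdf_pos
  have hsub : Ioi s ⊆ {t | 0 < ν.real (Iic t)} := fun t (ht : s < t) =>
    hs.trans_le (measureReal_mono (Iic_subset_Iic.2 ht.le))
  obtain ⟨c, hc⟩ := h.concaveOn_log_cdf.exists_affine_ge_of_mem_interior (x := 0)
    (interior_mono hsub (by rw [isOpen_Ioi.interior_eq]; exact hs0))
  have hmono : Monotone fun x => ν.real (Iic x) := fun x y h =>
    measureReal_mono (Iic_subset_Iic.2 h)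
  have hnn : ∀ x, 0 ≤ -Real.log (ν.real (Iic x)) := fun x =>
    neg_nonneg.2 (Real.log_nonpos measureReal_nonneg measureReal_le_one)
  have hint : Integrable (fun x => -Real.log (ν.real (Iic x))) ν := by
    refine ⟨hmono.measurable.log.neg.aestronglyMeasurable, ?_⟩
    rw [hasFiniteIntegral_iff_ofReal (Eventually.of_forall hnn)]
    exact lintegral_neg_log_cdf_le.trans_lt ENNReal.one_lt_top
  have h1 : ∫ x, -Real.log (ν.real (Iic x)) ∂ν ≤ 1 := by
    rw [integral_eq_lintegral_of_nonneg_ae (Eventually.of_forall hnn) hint.1]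
    exact ENNReal.toReal_mono ENNReal.one_ne_top lintegral_neg_log_cdf_le
  have hi : Integrable (fun x => c * x) ν := h.integrable_id.const_mul c
  have h2 : ∫ x, (-Real.log (ν.real (Iic 0)) - c * x) ∂ν ≤
      ∫ x, -Real.log (ν.real (Iic x)) ∂ν := by
    refine integral_mono_ae ((integrable_const _).sub hi) hint ?_
    filter_upwards [cdf_pos_ae (ν := ν)] with x hx
    have := hc x hx
    simp only [sub_zero] at this
    linarith
  rw [integral_sub (integrable_const _) hi, integral_const_mul, h.mean] at h2
  simp only [integral_const, probReal_univ, smul_eq_mul, one_mul, mul_zero, sub_zero] at h2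
  have hpos : 0 < ν.real (Iic 0) := hsub hs0
  rw [← Real.le_log_iff_exp_le hpos]
  linarith

/-- The mass of a half-line at distance `s` below the mean. -/
theorem exp_neg_one_sub_le_cdf (h : IsStandardLogConcave ν) {s : ℝ} (hs : 0 ≤ s) :
    Real.exp (-1) - s ≤ ν.real (Iic (-s)) := by
  have h1 := h.cdf_le_add (a := -s) (b := 0) (by linarith)
  have h2 := h.exp_neg_one_le_cdf_zero
  linarith

/-- Chebyshev's inequality about the point `c`. -/
lemma mul_measureReal_le (h : IsStandardLogConcave ν) {S : Set ℝ} (hS : MeasurableSet S) {c k : ℝ}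
    (hk : ∀ y ∈ S, k ≤ (y - c) ^ 2) : k * ν.real S ≤ 1 + c ^ 2 := by
  have hint : Integrable (fun y => (y - c) ^ 2) ν := (h.memLp.sub (memLp_const c)).integrable_sq
  have hi : Integrable (fun y => -2 * c * y) ν := h.integrable_id.const_mul _
  have hi' : Integrable (fun y => -2 * c * y + c ^ 2) ν := hi.add (integrable_const _)
  have e : ∫ y, (y - c) ^ 2 ∂ν = 1 + c ^ 2 := by
    have : ∀ y : ℝ, (y - c) ^ 2 = y ^ 2 + (-2 * c * y + c ^ 2) := fun y => by ring
    simp_rw [this]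
    rw [integral_add h.integrable_sq hi', integral_add hi (integrable_const _),
      integral_const_mul, h.mean, h.second]
    simp
  rw [← e]
  calc k * ν.real S = ∫ y in S, k ∂ν := by simp [mul_comm]
    _ ≤ ∫ y in S, (y - c) ^ 2 ∂ν :=
        setIntegral_mono_on (integrable_const _) hint.integrableOn hS hk
    _ ≤ ∫ y, (y - c) ^ 2 ∂ν :=
        setIntegral_le_integral hint (Eventually.of_forall fun y => sq_nonneg _)

/-- Exponential decay of the upper tail. Chebyshev's inequality gives `P(X ≥ -1) ≥ 1/2` and
`P(X ≥ 2) ≤ 1/5`; log-concavity extrapolates this drop to the point `r`. -/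
theorem le_four_mul_log_of_le_tail (h : IsStandardLogConcave ν) {r δ : ℝ} (hδ0 : 0 < δ)
    (hδ1 : δ < 1 / Real.exp 1) (hr : δ ≤ ν.real (Ici r)) : r ≤ 4 * Real.log (1 / δ) := by
  by_contra! hcon
  set L := Real.log (1 / δ) with hL
  have hδL : Real.log δ = -L := by rw [hL, one_div, Real.log_inv, neg_neg]
  have hL1 : 1 < L := by
    rw [hL, Real.lt_log_iff_exp_lt (by positivity), lt_div_iff₀ hδ0]
    rwa [lt_div_iff₀ (Real.exp_pos 1), mul_comm] at hδ1
  have h2 : ν.real (Ici 2) ≤ 1 / 5 := by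
    have := h.mul_measureReal_le (S := Ici 2) (c := -1 / 2) (k := 25 / 4) measurableSet_Ici
      (fun y (hy : 2 ≤ y) => by nlinarith)
    linarith
  have h1 : 1 / 2 ≤ ν.real (Ici (-1)) := by
    have := h.mul_measureReal_le (S := Iic (-1)) (c := 1) (k := 4) measurableSet_Iic
      (fun y (hy : y ≤ -1) => by nlinarith)
    rw [h.real_Ici]
    linarith
  set a : ℝ := 3 / (r + 1) with ha
  have ha0 : 0 ≤ a := div_nonneg (by norm_num) (by linarith)
  have ha1 : a ≤ 1 := (div_le_one (by linarith)).2 (by linarith)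
  have har : a * r + (1 - a) * (-1) = 2 := by
    rw [ha]
    have : r + 1 ≠ 0 := by linarith
    field_simp
    ring
  have h3 := ENNReal.toReal_mono (measure_ne_top _ _) (h.tail r (-1) a ha0 ha1)
  rw [har, ENNReal.toReal_mul, ← ENNReal.toReal_rpow, ← ENNReal.toReal_rpow, ← measureReal_def,
    ← measureReal_def, ← measureReal_def] at h3
  have h4 : δ ^ a * (1 / 2 : ℝ) ^ (1 - a) ≤ 1 / 5 := by
    refine le_trans ?_ (h3.trans h2)
    gcongr
  have h5 := Real.log_le_log (by positivity) h4
  rw [Real.log_mul (by positivity) (by positivity), Real.log_rpow hδ0,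
    Real.log_rpow (by norm_num), hδL, one_div, one_div, Real.log_inv, Real.log_inv] at h5
  have h6 : a * L ≤ 3 / 4 := by
    rw [ha, div_mul_eq_mul_div, div_le_iff₀ (by linarith)]
    linarith
  have h7 : Real.log 5 ≤ 3 / 4 + Real.log 2 := by
    have : 0 ≤ a * Real.log 2 := mul_nonneg ha0 (Real.log_nonneg (by norm_num))
    linarith
  have h8 : 3 / 4 < Real.log (5 / 2) := by
    rw [Real.lt_log_iff_exp_lt (by norm_num)]
    have h9 : Real.exp (3 / 4) ^ 4 = Real.exp 1 ^ 3 := by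
      rw [← Real.exp_nat_mul, ← Real.exp_nat_mul]; norm_num
    refine lt_of_pow_lt_pow_left₀ 4 (by norm_num) ?_
    rw [h9]
    calc Real.exp 1 ^ 3 < 3 ^ 3 := by
          gcongr
          exact Real.exp_one_lt_d9.trans (by norm_num)
      _ < (5 / 2) ^ 4 := by norm_num
  rw [Real.log_div (by norm_num) (by norm_num)] at h8
  linarith

end IsStandardLogConcave

end Grunbaum

/-! ### One-dimensional marginals and the Mahalanobis distance -/

section Marginal

open Set Filter Topology Matrix

variable {d : ℕ} {P : Measure (RSpace d)}

lemma inner_eq_dotProduct (z w : RSpace d) : inner ℝ z w = z.ofLp ⬝ᵥ w.ofLp := by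
  simp [PiLp.inner_apply, dotProduct, mul_comm]

lemma volume_hyperplane_eq_zero {w : RSpace d} (hw : w ≠ 0) (c : ℝ) :
    (volume : Measure (RSpace d)) {z | inner ℝ z w = c} = 0 := by
  rcases Set.eq_empty_or_nonempty {z : RSpace d | inner ℝ z w = c} with h | ⟨p, hp⟩
  · rw [h, measure_empty]
  have hsub : {z : RSpace d | inner ℝ z w = c} ⊆ AffineSubspace.mk' p (ℝ ∙ w)ᗮ := by
    intro z hz
    have hz' : inner ℝ z w = c := hz
    have hp' : inner ℝ p w = c := hp
    rw [SetLike.mem_coe, AffineSubspace.mem_mk', Submodule.mem_orthogonal_singleton_iff_inner_left,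
      vsub_eq_sub, inner_sub_left, hz', hp', sub_self]
  refine measure_mono_null hsub (Measure.addHaar_affineSubspace _ _ fun htop => ?_)
  have h1 : (ℝ ∙ w)ᗮ = ⊤ := by
    rw [← AffineSubspace.direction_mk' p (ℝ ∙ w)ᗮ, htop, AffineSubspace.direction_top]
  have h2 : w ∈ (ℝ ∙ w)ᗮ := h1 ▸ Submodule.mem_top
  rw [Submodule.mem_orthogonal_singleton_iff_inner_left, inner_self_eq_zero] at h2
  exact hw h2

/-- One-dimensional marginals of a log-concave measure have log-concave tails, because the
half-space `{z | s ≤ ⟨z, w⟩ + c}` depends affinely on `s`. -/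
lemma IsLogConcaveMeasure.hasLogConcaveTail_map (hP : IsLogConcaveMeasure P) {w : RSpace d}
    (hw : w ≠ 0) (c : ℝ) : HasLogConcaveTail (P.map fun z => inner ℝ z w + c) := by
  intro s t a ha0 ha1
  have hg : Measurable fun z : RSpace d => inner ℝ z w + c := by fun_prop
  have hS : ∀ r : ℝ, MeasurableSet ((fun z : RSpace d => inner ℝ z w + c) ⁻¹' Ici r) := fun r =>
    hg measurableSet_Ici
  have hne : ∀ r : ℝ, ((fun z : RSpace d => inner ℝ z w + c) ⁻¹' Ici r).Nonempty := fun r => by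
    refine ⟨((r - c) / inner ℝ w w) • w, ?_⟩
    have : inner ℝ w w ≠ 0 := inner_self_eq_zero.not.2 hw
    simp only [mem_preimage, mem_Ici, inner_smul_left, conj_trivial]
    rw [div_mul_cancel₀ _ this]
    linarith
  rw [Measure.map_apply hg measurableSet_Ici, Measure.map_apply hg measurableSet_Ici,
    Measure.map_apply hg measurableSet_Ici]
  refine (hP _ _ (hS s) (hS t) (hne s) (hne t) a ha0 ha1).trans (measure_mono ?_)
  rintro _ ⟨_, ⟨x, hx, rfl⟩, _, ⟨y, hy, rfl⟩, rfl⟩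
  simp only [mem_preimage, mem_Ici, inner_add_left, inner_smul_left, conj_trivial] at *
  nlinarith

variable [IsProbabilityMeasure P]

/-- A positive definite variance matrix forces finite second moments: the variance of a function
that is not square integrable is `0` by convention. -/
lemma memLp_coord (hS : (varianceMatrix P).PosDef) (i : Fin d) :
    MemLp (fun x : RSpace d => x i) 2 P := by
  by_contra h
  have h1 : Var[fun x : RSpace d => x i; P] = 0 :=
    variance_of_not_memLp (Measurable.aestronglyMeasurable (by fun_prop)) h
  have h2 : 0 < varianceMatrix P i i := hS.diag_pos
  rw [varianceMatrix, Matrix.of_apply, covariance_self (Measurable.aemeasurable (by fun_prop)),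
    h1] at h2
  exact lt_irrefl _ h2

lemma inner_eq_sum (z w : RSpace d) : inner ℝ z w = ∑ i, w i * z i := by
  simp [PiLp.inner_apply]

lemma memLp_inner (hS : (varianceMatrix P).PosDef) (w : RSpace d) :
    MemLp (fun z : RSpace d => inner ℝ z w) 2 P := by
  simp_rw [inner_eq_sum]
  exact memLp_finsetSum _ fun i _ => (memLp_coord hS i).const_mul _

lemma integrable_coe_self (hS : (varianceMatrix P).PosDef) :
    Integrable (fun z : RSpace d => z) P :=
  Integrable.of_eval_piLp fun i => (memLp_coord hS i).integrable one_le_two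

lemma integral_inner_eq (hS : (varianceMatrix P).PosDef) (w : RSpace d) :
    ∫ z, inner ℝ z w ∂P = inner ℝ (meanVector P) w := by
  rw [real_inner_comm, meanVector, ← integral_inner (integrable_coe_self hS)]
  simp_rw [real_inner_comm]

lemma variance_inner (hS : (varianceMatrix P).PosDef) (w : RSpace d) :
    Var[fun z : RSpace d => inner ℝ z w; P] = w.ofLp ⬝ᵥ varianceMatrix P *ᵥ w.ofLp := by
  rw [← covariance_self (Measurable.aemeasurable (by fun_prop))]
  simp_rw [inner_eq_sum]
  rw [covariance_fun_sum_fun_sum (fun i => (memLp_coord hS i).const_mul _)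
    (fun i => (memLp_coord hS i).const_mul _)]
  simp only [covariance_const_mul_left, covariance_const_mul_right, dotProduct, mulVec,
    varianceMatrix, Matrix.of_apply, Finset.mul_sum]
  refine Finset.sum_congr rfl fun i _ => Finset.sum_congr rfl fun j _ => by ring

lemma quadForm_pos {S : Matrix (Fin d) (Fin d) ℝ} (hS : S.PosDef) {w : RSpace d} (hw : w ≠ 0) :
    0 < w.ofLp ⬝ᵥ S *ᵥ w.ofLp := by
  have := hS.dotProduct_mulVec_pos (x := w.ofLp) (by simpa using hw)
  simpa using this

lemma notOnHyperplane_of_posDef (hS : (varianceMatrix P).PosDef) : NotOnHyperplane P := by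
  intro u c hu hae
  have h1 := variance_inner hS u
  rw [variance_congr (Y := fun _ => c) hae, ← covariance_self aemeasurable_const,
    covariance_const_left] at h1
  exact (quadForm_pos hS hu).ne h1

/-- The standardized marginals of a log-concave measure are standard log-concave. -/
lemma isStandardLogConcave_marginal (hP : IsLogConcaveMeasure P)
    (hS : (varianceMatrix P).PosDef) {w : RSpace d}
    (hw : w.ofLp ⬝ᵥ varianceMatrix P *ᵥ w.ofLp = 1) :
    IsStandardLogConcave (P.map fun z => inner ℝ z w + -inner ℝ (meanVector P) w) := by
  have hw0 : w ≠ 0 := by rintro rfl; simp at hw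
  have hg : Measurable fun z : RSpace d => inner ℝ z w + -inner ℝ (meanVector P) w := by fun_prop
  have hmem : MemLp (fun z : RSpace d => inner ℝ z w + -inner ℝ (meanVector P) w) 2 P :=
    (memLp_inner hS w).add (memLp_const _)
  refine ⟨hP.hasLogConcaveTail_map hw0 _, ?_, ?_, ?_, ?_, ⟨fun x => ?_⟩⟩
  · rw [Measure.map_map measurable_neg hg]
    have h := hP.hasLogConcaveTail_map (neg_ne_zero.2 hw0) (inner ℝ (meanVector P) w)
    convert h using 2
    ext z
    simp only [Function.comp_apply, inner_neg_right]
    ring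
  · rw [integrable_map_measure (by fun_prop) hg.aemeasurable]
    exact hmem.integrable_sq
  · rw [integral_map hg.aemeasurable (by fun_prop), integral_add
      ((memLp_inner hS w).integrable one_le_two) (integrable_const _), integral_inner_eq hS]
    simp
  · rw [integral_map hg.aemeasurable (by fun_prop), ← hw, ← variance_inner hS,
      variance_eq_integral (Measurable.aemeasurable (by fun_prop)), integral_inner_eq hS]
    simp_rw [sub_eq_add_neg]
  · rw [Measure.map_apply hg (measurableSet_singleton x)]
    refine absolutelyContinuous_of_isLogConcaveMeasure hP (notOnHyperplane_of_posDef hS)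
      (measure_mono_null (fun z hz => ?_)
        (volume_hyperplane_eq_zero hw0 (x + inner ℝ (meanVector P) w)))
    simp only [mem_preimage, mem_singleton_iff] at hz
    change inner ℝ z w = _
    linarith

/-- The Cauchy-Schwarz inequality for the Mahalanobis norm and its dual. -/
lemma abs_inner_le_mahalanobis {S : Matrix (Fin d) (Fin d) ℝ} (hS : S.PosDef) (x y : RSpace d)
    {w : RSpace d} (hw : w.ofLp ⬝ᵥ S *ᵥ w.ofLp = 1) :
    |inner ℝ (x - y) w| ≤ mahalanobisDist S x y := by
  refine Real.abs_le_sqrt ?_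
  set v := (x - y).ofLp with hv
  rw [inner_eq_dotProduct, ← hv]
  set q := S⁻¹ *ᵥ v with hq
  have hSq : S *ᵥ q = v := by
    rw [hq, mulVec_mulVec, mul_nonsing_inv _ ((isUnit_iff_isUnit_det _).1 hS.isUnit), one_mulVec]
  have hsymm : w.ofLp ⬝ᵥ S *ᵥ q = q ⬝ᵥ S *ᵥ w.ofLp := by
    have hT : Sᵀ = S := by simpa using hS.isHermitian.eq
    rw [dotProduct_mulVec, ← mulVec_transpose, hT, dotProduct_comm]
  have h := hS.posSemidef.dotProduct_mulVec_nonneg (q - (v ⬝ᵥ w.ofLp) • w.ofLp)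
  simp only [star_trivial, mulVec_sub, mulVec_smul, sub_dotProduct, dotProduct_sub,
    smul_dotProduct, dotProduct_smul, smul_eq_mul, hw, ← hsymm, hSq, dotProduct_comm w.ofLp v] at h
  rw [dotProduct_comm q v] at h
  nlinarith

theorem mahalanobisEllipsoid_subset_depthRegion (hP : IsLogConcaveMeasure P)
    (hS : (varianceMatrix P).PosDef) {δ : ℝ} :
    mahalanobisEllipsoid P (1 / Real.exp 1 - δ) ⊆ depthRegion P δ := by
  intro x (hx : mahalanobisDist _ _ _ ≤ _)
  change ENNReal.ofReal δ ≤ halfspaceDepth x P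
  unfold halfspaceDepth
  refine le_iInf₂ fun u hu => le_iInf₂ fun b hb => ?_
  have hpos := quadForm_pos hS hu
  set σ := Real.sqrt (u.ofLp ⬝ᵥ varianceMatrix P *ᵥ u.ofLp) with hσ
  have hσ0 : 0 < σ := Real.sqrt_pos.2 hpos
  have hw : (σ⁻¹ • u).ofLp ⬝ᵥ varianceMatrix P *ᵥ (σ⁻¹ • u).ofLp = 1 := by
    simp only [WithLp.ofLp_smul, mulVec_smul, dotProduct_smul, smul_dotProduct, smul_eq_mul]
    rw [← Real.sq_sqrt hpos.le, ← hσ]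
    field_simp
  have hstd := isStandardLogConcave_marginal hP hS hw
  have hg : Measurable fun z : RSpace d =>
    inner ℝ z (σ⁻¹ • u) + -inner ℝ (meanVector P) (σ⁻¹ • u) := by fun_prop
  have : IsProbabilityMeasure
      (P.map fun z => inner ℝ z (σ⁻¹ • u) + -inner ℝ (meanVector P) (σ⁻¹ • u)) :=
    Measure.isProbabilityMeasure_map hg.aemeasurable
  have hd0 : 0 ≤ mahalanobisDist (varianceMatrix P) x (meanVector P) := Real.sqrt_nonneg _
  have h1 := hstd.exp_neg_one_sub_le_cdf hd0
  have h2 := (abs_le.1 (abs_inner_le_mahalanobis hS x (meanVector P) hw)).1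
  rw [Real.exp_neg, ← one_div] at h1
  rw [measureReal_def, Measure.map_apply hg measurableSet_Iic] at h1
  rw [ENNReal.ofReal_le_iff_le_toReal (measure_ne_top _ _)]
  refine le_trans (by linarith) (h1.trans (ENNReal.toReal_mono (measure_ne_top _ _)
    (measure_mono fun z hz => ?_)))
  simp only [mem_preimage, mem_Iic] at hz
  rw [inner_sub_left] at h2
  have h3 : inner ℝ z (σ⁻¹ • u) ≤ inner ℝ x (σ⁻¹ • u) := by linarith
  rw [inner_smul_right, inner_smul_right] at h3
  exact (le_of_mul_le_mul_left h3 (by positivity)).trans hb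

theorem depthRegion_subset_mahalanobisEllipsoid_four (hP : IsLogConcaveMeasure P)
    (hS : (varianceMatrix P).PosDef) {δ : ℝ} (hδ0 : 0 < δ) (hδ1 : δ < 1 / Real.exp 1) :
    depthRegion P δ ⊆ mahalanobisEllipsoid P (4 * Real.log (1 / δ)) := by
  intro x hx
  change mahalanobisDist _ _ _ ≤ _
  have hlog : 0 ≤ Real.log (1 / δ) := by
    refine Real.log_nonneg ?_
    rw [le_div_iff₀ hδ0]
    have : 1 / Real.exp 1 ≤ 1 := (div_le_one (Real.exp_pos 1)).2 (Real.one_le_exp zero_le_one)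
    linarith
  set r := mahalanobisDist (varianceMatrix P) x (meanVector P) with hr
  rcases (show 0 ≤ r from Real.sqrt_nonneg _).eq_or_lt with h0 | hr0
  · rw [← h0]; positivity
  set S := varianceMatrix P with hSdef
  set v := (x - meanVector P).ofLp with hv
  have hr2 : r ^ 2 = v ⬝ᵥ S⁻¹ *ᵥ v := by
    rw [hr, mahalanobisDist, Real.sq_sqrt]
    have := hS.inv.posSemidef.dotProduct_mulVec_nonneg v
    simpa only [star_trivial] using this
  -- The halfspace through `x` whose bounding hyperplane is tangent to the ellipsoid.
  set w : RSpace d := WithLp.toLp 2 (r⁻¹ • S⁻¹ *ᵥ v) with hwdef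
  have hw : w.ofLp ⬝ᵥ S *ᵥ w.ofLp = 1 := by
    rw [hwdef]
    simp only [mulVec_smul, dotProduct_smul, smul_dotProduct, smul_eq_mul]
    rw [mulVec_mulVec, mul_nonsing_inv _ ((isUnit_iff_isUnit_det _).1 hS.isUnit), one_mulVec,
      dotProduct_comm, ← hr2]
    field_simp
  have hxw : inner ℝ x w + -inner ℝ (meanVector P) w = r := by
    rw [← sub_eq_add_neg, ← inner_sub_left, inner_eq_dotProduct, ← hv, hwdef]
    simp only [dotProduct_smul, smul_eq_mul]
    rw [← hr2]
    field_simp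
  have hw0 : w ≠ 0 := by intro h; rw [h] at hw; simp at hw
  have hstd := isStandardLogConcave_marginal hP hS hw
  have hg : Measurable fun z : RSpace d =>
    inner ℝ z w + -inner ℝ (meanVector P) w := by fun_prop
  have : IsProbabilityMeasure (P.map fun z => inner ℝ z w + -inner ℝ (meanVector P) w) :=
    Measure.isProbabilityMeasure_map hg.aemeasurable
  refine hstd.le_four_mul_log_of_le_tail hδ0 hδ1 ?_
  rw [measureReal_def, Measure.map_apply hg measurableSet_Ici,
    ← ENNReal.ofReal_le_iff_le_toReal (measure_ne_top _ _)]
  have hx' : ENNReal.ofReal δ ≤ halfspaceDepth x P := hx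
  refine hx'.trans ((iInf₂_le (-w) (neg_ne_zero.2 hw0)).trans
    ((iInf₂_le (inner ℝ x (-w)) le_rfl).trans (measure_mono fun z hz => ?_)))
  have hz' : inner ℝ z (-w) ≤ inner ℝ x (-w) := hz
  rw [inner_neg_right, inner_neg_right] at hz'
  simp only [mem_preimage, mem_Ici]
  linarith

end Marginal

/-! ### The isotropic constant -/

section IsotropicConstant

open Set Filter Topology Matrix

variable {d : ℕ}

/-- A log-concave function with finite integral is bounded: a large value at `x` forces, by
log-concavity, large values on the half-way contraction towards `x` of a fixed set of positive
volume. -/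
lemma IsLogConcaveFun.bddAbove_range {f : RSpace d → ℝ} (hf : IsLogConcaveFun f)
    (hfm : Measurable f) (h0 : ∫⁻ x, ENNReal.ofReal (f x) ≠ 0)
    (hfin : ∫⁻ x, ENNReal.ofReal (f x) ≠ ∞) : BddAbove (range f) := by
  obtain ⟨c, hc0, hc⟩ : ∃ c : ℝ, 0 < c ∧ (volume : Measure (RSpace d)) {x | c < f x} ≠ 0 := by
    by_contra! hcon
    refine h0 ((lintegral_eq_zero_iff hfm.ennreal_ofReal).2 ?_)
    have hU : {x | 0 < f x} = ⋃ n : ℕ, {x | 1 / ((n : ℝ) + 1) < f x} := by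
      ext x
      simp only [mem_ofPred_eq, mem_iUnion]
      constructor
      · exact fun hx => exists_nat_one_div_lt hx
      · rintro ⟨n, hn⟩
        exact lt_trans (by positivity) hn
    have hnull : (volume : Measure (RSpace d)) {x | 0 < f x} = 0 := by
      rw [hU]
      exact measure_iUnion_null fun n => hcon _ (by positivity)
    filter_upwards [measure_eq_zero_iff_ae_notMem.1 hnull] with x hx
    simpa using hx
  set I := ∫⁻ x, ENNReal.ofReal (f x) with hI
  set V := (volume : Measure (RSpace d)) {x | c < f x} with hV
  set k : ℝ≥0∞ := ENNReal.ofReal |(1 / 2 : ℝ) ^ Module.finrank ℝ (RSpace d)| with hk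
  have hk0 : k ≠ 0 := by rw [hk]; simp
  have hkV : k * V ≠ 0 := mul_ne_zero hk0 hc
  refine ⟨(I / (k * V)).toReal ^ 2 / c, ?_⟩
  rintro _ ⟨x, rfl⟩
  have hsub : AffineMap.homothety x (1 / 2 : ℝ) '' {y | c < f y} ⊆
      {z | ENNReal.ofReal (Real.sqrt (f x * c)) ≤ ENNReal.ofReal (f z)} := by
    rintro _ ⟨y, hy, rfl⟩
    have h := hf.2 x y (1 / 2) (by norm_num) (by norm_num)
    have hz : AffineMap.homothety x (1 / 2 : ℝ) y = (1 / 2 : ℝ) • x + (1 - 1 / 2 : ℝ) • y := by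
      rw [AffineMap.homothety_apply, vsub_eq_sub, vadd_eq_add]
      module
    change _ ≤ ENNReal.ofReal (f (AffineMap.homothety x (1 / 2 : ℝ) y))
    rw [hz]
    refine ENNReal.ofReal_le_ofReal (le_trans ?_ h)
    rw [show (1 - 1 / 2 : ℝ) = 1 / 2 by norm_num, ← Real.sqrt_eq_rpow, ← Real.sqrt_eq_rpow,
      Real.sqrt_mul (hf.1 x)]
    have hy' : c < f y := hy
    gcongr
  have h1 : ENNReal.ofReal (Real.sqrt (f x * c)) * (k * V) ≤ I := by
    refine le_trans ?_ (mul_meas_ge_le_lintegral hfm.ennreal_ofReal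
      (ENNReal.ofReal (Real.sqrt (f x * c))))
    gcongr
    rw [hk, hV, ← Measure.addHaar_image_homothety _ x]
    exact measure_mono hsub
  have h2 : ENNReal.ofReal (Real.sqrt (f x * c)) ≤ I / (k * V) := by
    refine (ENNReal.le_div_iff_mul_le (Or.inl hkV) (Or.inr hfin)).2 h1
  have h3 : Real.sqrt (f x * c) ≤ (I / (k * V)).toReal :=
    (ENNReal.ofReal_le_iff_le_toReal (ENNReal.div_ne_top hfin hkV)).1 h2
  rw [le_div_iff₀ hc0]
  exact (Real.sqrt_le_left ENNReal.toReal_nonneg).1 h3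

lemma integrable_inner_sq_of_isIsotropicMeasure {Q : Measure (RSpace d)}
    (hQ : IsIsotropicMeasure Q) {u : RSpace d} (hu : ‖u‖ = 1) :
    Integrable (fun x : RSpace d => (inner ℝ x u) ^ 2) Q := by
  by_contra h
  have := hQ.2 u hu
  rw [integral_undef h] at this
  exact zero_ne_one this

lemma norm_sq_eq_sum_inner_sq (x : RSpace d) :
    ‖x‖ ^ 2 = ∑ i, (inner ℝ x (EuclideanSpace.single i (1 : ℝ))) ^ 2 := by
  rw [EuclideanSpace.norm_sq_eq]
  refine Finset.sum_congr rfl fun i _ => ?_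
  rw [EuclideanSpace.inner_single_right]
  simp

lemma integrable_norm_sq_of_isIsotropicMeasure {Q : Measure (RSpace d)}
    (hQ : IsIsotropicMeasure Q) : Integrable (fun x : RSpace d => ‖x‖ ^ 2) Q := by
  simp_rw [norm_sq_eq_sum_inner_sq]
  exact integrable_finsetSum _ fun i _ =>
    integrable_inner_sq_of_isIsotropicMeasure hQ (by simp)

lemma integral_norm_sq_of_isIsotropicMeasure {Q : Measure (RSpace d)}
    (hQ : IsIsotropicMeasure Q) : ∫ x, ‖x‖ ^ 2 ∂Q = d := by
  simp_rw [norm_sq_eq_sum_inner_sq]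
  rw [integral_finsetSum _ fun i _ =>
    integrable_inner_sq_of_isIsotropicMeasure hQ (by simp)]
  rw [Finset.sum_congr rfl fun i _ => hQ.2 (EuclideanSpace.single i 1) (by simp)]
  simp

/-- Integrating the unnormalized Gaussian `exp (-‖x‖² / 2)` against an isotropic measure with
density `f ≤ M` gives at most `M (2π)^(d/2)`, and, as `exp y ≥ 1 + y`, at least `exp (-d / 2)`. -/
lemma exp_neg_le_sup_density_mul {Q : Measure (RSpace d)} [IsProbabilityMeasure Q]
    (hQ : IsIsotropicMeasure Q) {f : RSpace d → ℝ} (hfm : Measurable f)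
    (hf : Q = volume.withDensity fun x => ENNReal.ofReal (f x)) {M : ℝ} (hM0 : 0 ≤ M)
    (hM : ∀ x, f x ≤ M) :
    Real.exp (-(d / 2 : ℝ)) ≤ M * (2 * Real.pi) ^ (d / 2 : ℝ) := by
  have hi : Integrable (fun x : RSpace d => Real.exp (-(1 / 2) * ‖x‖ ^ 2)) volume := by
    have := (GaussianFourier.integrable_cexp_neg_mul_sq_norm_add (V := RSpace d)
      (b := (1 / 2 : ℂ)) (by norm_num) 0 0).norm
    refine this.congr (Eventually.of_forall fun x => ?_)
    simp only [Complex.norm_exp]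
    congr 1
    simp [← Complex.ofReal_pow]
  have hgint := GaussianFourier.integral_rexp_neg_mul_sq_norm (V := RSpace d)
    (b := 1 / 2) (by norm_num)
  rw [finrank_euclideanSpace_fin, show Real.pi / (1 / 2) = 2 * Real.pi by ring] at hgint
  have hub : ∫⁻ x, ENNReal.ofReal (Real.exp (-(1 / 2) * ‖x‖ ^ 2)) ∂Q ≤
      ENNReal.ofReal (M * (2 * Real.pi) ^ (d / 2 : ℝ)) := by
    rw [hf, lintegral_withDensity_eq_lintegral_mul _ hfm.ennreal_ofReal (by fun_prop), ← hgint,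
      ENNReal.ofReal_mul hM0, ofReal_integral_eq_lintegral_ofReal hi
        (Eventually.of_forall fun x => (Real.exp_pos _).le),
      ← lintegral_const_mul _ (by fun_prop)]
    refine lintegral_mono fun x => ?_
    simp only [Pi.mul_apply]
    gcongr
    exact hM x
  have hnorm := integrable_norm_sq_of_isIsotropicMeasure hQ
  have hQi : Integrable (fun x : RSpace d => Real.exp (-(1 / 2) * ‖x‖ ^ 2)) Q := by
    refine Integrable.of_bound (C := 1) (Measurable.aestronglyMeasurable (by fun_prop))
      (Eventually.of_forall fun x => ?_)
    rw [Real.norm_of_nonneg (Real.exp_pos _).le, Real.exp_le_one_iff]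
    nlinarith [sq_nonneg ‖x‖]
  rw [← ofReal_integral_eq_lintegral_ofReal hQi
    (Eventually.of_forall fun x => (Real.exp_pos _).le),
    ENNReal.ofReal_le_ofReal_iff (by positivity)] at hub
  refine le_trans ?_ hub
  have hlow : ∫ x, Real.exp (-(d / 2 : ℝ)) * (1 + d / 2 - 1 / 2 * ‖x‖ ^ 2) ∂Q =
      Real.exp (-(d / 2 : ℝ)) := by
    rw [integral_const_mul, integral_sub (integrable_const _) (hnorm.const_mul _),
      integral_const_mul, integral_norm_sq_of_isIsotropicMeasure hQ]
    simp
    ring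
  rw [← hlow]
  refine integral_mono (((integrable_const _).sub (hnorm.const_mul _)).const_mul _) hQi
    fun x => ?_
  simp only
  rw [show -(1 / 2) * ‖x‖ ^ 2 = -(d / 2 : ℝ) + (d / 2 - 1 / 2 * ‖x‖ ^ 2) by ring, Real.exp_add]
  gcongr
  linarith [Real.add_one_le_exp (d / 2 - 1 / 2 * ‖x‖ ^ 2 : ℝ)]

/-- The isotropic constant is at least `(2πe)^(-1/2)`, which exceeds `4 / 17`. -/
theorem four_le_seventeen_mul_of_isIsotropicConstant (hd : 0 < d) {P : Measure (RSpace d)}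
    [IsProbabilityMeasure P] {L : ℝ} (hL : IsIsotropicConstant P L) : 4 ≤ 17 * L := by
  obtain ⟨T, f, hiso, ⟨hlc, hfm, hf⟩, rfl⟩ := hL
  have hTm : Measurable T := (AffineEquiv.continuous_of_finiteDimensional T).measurable
  have : IsProbabilityMeasure (P.map T) := Measure.isProbabilityMeasure_map hTm.aemeasurable
  have hone : ∫⁻ x, ENNReal.ofReal (f x) = 1 := by
    rw [← setLIntegral_univ, ← withDensity_apply _ MeasurableSet.univ, ← hf, measure_univ]
  have hbdd : BddAbove (range f) :=
    hlc.bddAbove_range hfm (by rw [hone]; exact one_ne_zero)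
      (by rw [hone]; exact ENNReal.one_ne_top)
  have hM : ∀ x, f x ≤ ⨆ x, f x := fun x => le_ciSup hbdd x
  have hM0 : 0 ≤ ⨆ x, f x := (hlc.1 0).trans (hM 0)
  have h := exp_neg_le_sup_density_mul hiso hfm hf hM0 hM
  set M := ⨆ x, f x
  have hd' : (0 : ℝ) < d := by exact_mod_cast hd
  have hpi := Real.pi_pos
  have h1 : (2 * Real.pi * Real.exp 1) ^ (-(d / 2 : ℝ)) ≤ M := by
    rw [Real.rpow_neg (by positivity), Real.mul_rpow (by positivity) (by positivity),
      Real.exp_one_rpow, mul_inv, ← Real.exp_neg, inv_mul_le_iff₀ (by positivity), mul_comm]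
    exact h
  have h2 := Real.rpow_le_rpow (by positivity) h1 (by positivity : 0 ≤ 1 / (d : ℝ))
  rw [← Real.rpow_mul (by positivity), show -(d / 2 : ℝ) * (1 / d) = -(1 / 2) by field_simp,
    Real.rpow_neg (by positivity), ← Real.sqrt_eq_rpow] at h2
  have h3 : Real.sqrt (2 * Real.pi * Real.exp 1) ≤ 17 / 4 := by
    rw [Real.sqrt_le_left (by norm_num)]
    have e1 := Real.exp_one_lt_d9
    have e2 := Real.pi_lt_d2
    have : Real.pi * Real.exp 1 ≤ 3.15 * 2.7182818286 := by gcongr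
    nlinarith
  have h4 : 4 / 17 ≤ (Real.sqrt (2 * Real.pi * Real.exp 1))⁻¹ := by
    rw [show (4 / 17 : ℝ) = (17 / 4)⁻¹ by norm_num]
    exact inv_anti₀ (by positivity) h3
  linarith

lemma IsLogConcaveMeasure.map_affineEquiv {P : Measure (RSpace d)} (hP : IsLogConcaveMeasure P)
    (T : RSpace d ≃ᵃ[ℝ] RSpace d) : IsLogConcaveMeasure (P.map T) := by
  have hTm : Measurable T := (AffineEquiv.continuous_of_finiteDimensional T).measurable
  intro A B hA hB hAne hBne t ht0 ht1
  rw [Measure.map_apply hTm hA, Measure.map_apply hTm hB]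
  refine (hP _ _ (hTm hA) (hTm hB) (hAne.preimage T.surjective) (hBne.preimage T.surjective)
    t ht0 ht1).trans ((measure_mono ?_).trans (Measure.le_map_apply hTm.aemeasurable _))
  rintro _ ⟨_, ⟨x, hx, rfl⟩, _, ⟨y, hy, rfl⟩, rfl⟩
  refine ⟨_, ⟨T x, hx, rfl⟩, _, ⟨T y, hy, rfl⟩, ?_⟩
  have h := Convex.combo_affine_apply (f := (T : RSpace d →ᵃ[ℝ] RSpace d)) (x := x) (y := y)
    (a := t) (b := 1 - t) (by ring)
  exact h.symm

open scoped MatrixOrder in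
/-- A whitening matrix of a positive definite matrix. -/
lemma exists_mul_mul_transpose_eq_one {S : Matrix (Fin d) (Fin d) ℝ} (hS : S.PosDef) :
    ∃ A : Matrix (Fin d) (Fin d) ℝ, IsUnit A ∧ A * S * Aᵀ = 1 := by
  obtain ⟨B, hB⟩ := CStarAlgebra.nonneg_iff_eq_star_mul_self.1 hS.posSemidef.nonneg
  have hB' : S = Bᵀ * B := by
    rw [hB, star_eq_conjTranspose, conjTranspose_eq_transpose_of_trivial]
  have hdet : IsUnit B.det := by
    have := (isUnit_iff_isUnit_det _).1 hS.isUnit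
    rw [hB', det_mul] at this
    exact isUnit_of_mul_isUnit_right this
  have hdetT : IsUnit Bᵀ.det := by rwa [det_transpose]
  refine ⟨Bᵀ⁻¹, (isUnit_nonsing_inv_iff).2 ((isUnit_iff_isUnit_det _).2 hdetT), ?_⟩
  rw [hB', ← Matrix.mul_assoc, nonsing_inv_mul _ hdetT, Matrix.one_mul, transpose_nonsing_inv,
    transpose_transpose, mul_nonsing_inv _ hdet]

lemma exists_continuousLinearEquiv_inner_eq {A : Matrix (Fin d) (Fin d) ℝ} (hA : IsUnit A) :
    ∃ e : RSpace d ≃L[ℝ] RSpace d, ∀ z u : RSpace d,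
      inner ℝ (e z) u = inner ℝ z (WithLp.toLp 2 (Aᵀ *ᵥ u.ofLp)) := by
  have hAdet := (isUnit_iff_isUnit_det _).1 hA
  have hinj : Function.Injective (Matrix.toEuclideanLin A) := by
    intro x y hxy
    have h1 : A *ᵥ x.ofLp = A *ᵥ y.ofLp := congrArg WithLp.ofLp hxy
    have h2 := congrArg (fun v => A⁻¹ *ᵥ v) h1
    simp only [mulVec_mulVec, nonsing_inv_mul _ hAdet, one_mulVec] at h2
    exact WithLp.ofLp_injective 2 h2
  refine ⟨(LinearEquiv.ofBijective (Matrix.toEuclideanLin A)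
    ⟨hinj, LinearMap.injective_iff_surjective.1 hinj⟩).toContinuousLinearEquiv, fun z u => ?_⟩
  rw [inner_eq_dotProduct, inner_eq_dotProduct]
  change (A *ᵥ z.ofLp) ⬝ᵥ u.ofLp = _
  rw [mulVec_transpose, dotProduct_comm z.ofLp, ← dotProduct_mulVec, dotProduct_comm]

/-- A log-concave measure with positive definite variance matrix has an isotropic constant:
whitening makes it isotropic, and Borell's theorem provides the density. -/
theorem exists_isIsotropicConstant {P : Measure (RSpace d)} [IsProbabilityMeasure P]
    (hP : IsLogConcaveMeasure P) (hS : (varianceMatrix P).PosDef) :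
    ∃ L, IsIsotropicConstant P L := by
  obtain ⟨A, hA, hASA⟩ := exists_mul_mul_transpose_eq_one hS
  obtain ⟨e, hinner⟩ := exists_continuousLinearEquiv_inner_eq hA
  obtain ⟨T, hTapp⟩ : ∃ T : RSpace d ≃ᵃ[ℝ] RSpace d, ∀ z, T z = e (z - meanVector P) := by
    refine ⟨(AffineEquiv.constVAdd ℝ (RSpace d) (-meanVector P)).trans
      e.toLinearEquiv.toAffineEquiv, fun z => ?_⟩
    change e (-meanVector P + z) = _
    rw [neg_add_eq_sub]
  have hTm : Measurable T := (AffineEquiv.continuous_of_finiteDimensional T).measurable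
  have : IsProbabilityMeasure (P.map T) := Measure.isProbabilityMeasure_map hTm.aemeasurable
  have hw0 : ∀ u : RSpace d, u ≠ 0 → WithLp.toLp 2 (Aᵀ *ᵥ u.ofLp) ≠ 0 := by
    intro u hu h
    have h1 : ∀ z, inner ℝ (e z) u = 0 := fun z => by rw [hinner, h, inner_zero_right]
    obtain ⟨z, hz⟩ := e.surjective u
    have := h1 z
    rw [hz, inner_self_eq_zero] at this
    exact hu this
  have hnd : NotOnHyperplane (P.map T) := by
    intro u c hu hae
    rw [ae_map_iff hTm.aemeasurable (measurableSet_eq_fun (by fun_prop) measurable_const)] at hae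
    refine notOnHyperplane_of_posDef hS (WithLp.toLp 2 (Aᵀ *ᵥ u.ofLp))
      (c + inner ℝ (meanVector P) (WithLp.toLp 2 (Aᵀ *ᵥ u.ofLp))) (hw0 u hu) ?_
    filter_upwards [hae] with z hz
    rw [hTapp, hinner, inner_sub_left] at hz
    linarith
  obtain ⟨f, hf⟩ := exists_isLogConcaveDensity (hP.map_affineEquiv T) hnd
  refine ⟨_, T, f, ⟨?_, fun u hu => ?_⟩, hf, rfl⟩
  · rw [meanVector, integral_map hTm.aemeasurable (by fun_prop)]
    simp_rw [hTapp]
    rw [ContinuousLinearEquiv.integral_comp_comm, integral_sub (integrable_coe_self hS)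
      (integrable_const _)]
    simp [meanVector]
  · rw [integral_map hTm.aemeasurable (by fun_prop)]
    simp_rw [hTapp, hinner]
    set w : RSpace d := WithLp.toLp 2 (Aᵀ *ᵥ u.ofLp) with hw
    have hquad : w.ofLp ⬝ᵥ varianceMatrix P *ᵥ w.ofLp = 1 := by
      have h1 : u.ofLp ⬝ᵥ (A * varianceMatrix P * Aᵀ) *ᵥ u.ofLp = 1 := by
        rw [hASA, one_mulVec, ← inner_eq_dotProduct, real_inner_self_eq_norm_sq, hu, one_pow]
      rw [← h1, hw, ← mulVec_mulVec, ← mulVec_mulVec]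
      change (Aᵀ *ᵥ u.ofLp) ⬝ᵥ _ = _
      rw [mulVec_transpose, ← dotProduct_mulVec]
    rw [← hquad, ← variance_inner hS,
      variance_eq_integral (Measurable.aemeasurable (by fun_prop)), integral_inner_eq hS]
    simp_rw [inner_sub_left]

theorem four_le_seventeen_mul_isotropicConstant (hd : 0 < d) {P : Measure (RSpace d)}
    [IsProbabilityMeasure P] (hP : IsLogConcaveMeasure P) (hS : (varianceMatrix P).PosDef) :
    4 ≤ 17 * isotropicConstant P := by
  have h := exists_isIsotropicConstant hP hS
  rw [isotropicConstant, dif_pos h]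
  exact four_le_seventeen_mul_of_isIsotropicConstant hd h.choose_spec

end IsotropicConstant

/-! ### Depth regions and Mahalanobis ellipsoids -/

theorem mainTheorem6 (d : ℕ) (hd : 0 < d) (P : Measure (RSpace d)) [IsProbabilityMeasure P]
    (hP : IsLogConcaveMeasure P) (hS : (varianceMatrix P).PosDef)
    (δ : ℝ) (hδ0 : 0 < δ) (hδ1 : δ < 1 / Real.exp 1) :
    mahalanobisEllipsoid P (1 / Real.exp 1 - δ) ⊆ depthRegion P δ ∧
    depthRegion P δ ⊆ mahalanobisEllipsoid P (17 * Real.log (1 / δ) * isotropicConstant P) ∧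
    depthRegion P δ ⊆ mahalanobisEllipsoid P (17 * Real.log (1 / δ)) := by
  have hsub := depthRegion_subset_mahalanobisEllipsoid_four hP hS hδ0 hδ1
  have hlog : 0 ≤ Real.log (1 / δ) := by
    refine Real.log_nonneg ((one_le_div hδ0).2 (hδ1.le.trans ?_))
    exact (div_le_one (Real.exp_pos 1)).2 (Real.one_le_exp zero_le_one)
  have hL := four_le_seventeen_mul_isotropicConstant hd hP hS
  refine ⟨mahalanobisEllipsoid_subset_depthRegion hP hS, fun x hx => ?_, fun x hx => ?_⟩ <;>
  · have h : mahalanobisDist (varianceMatrix P) x (meanVector P) ≤ 4 * Real.log (1 / δ) := hsub hx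
    change mahalanobisDist (varianceMatrix P) x (meanVector P) ≤ _
    nlinarith
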